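/- Let $p$ and $q$ be prime numbers with $p\equiv 5\pmod 8$, $q\equiv 3\pmod 8$ and Legendre symbol $\left(\frac{p}{q}\right)=1$. For a square-free integer $d>1$ let $\varepsilon_d>1$ denote the fundamental unit of the real quadratic field $\mathbb{Q}(\sqrt d)$, i.e. the least unit greater than $1$ of its ring of integers. A fundamental system of units of a number field $k$ is a family $(u_1,\dots,u_r)$ of units of its ring of integers such that every unit can be written in exactly one way as $\zeta u_1^{n_1}\cdots u_r^{n_r}$ with $\zeta$ a root of unity in $k$ and $n_1,\dots,n_r\in\mathbb{Z}$. All square roots are the positive real ones. Then: 1. A fundamental system of units of $\mathbb{Q}(\sqrt{p},\sqrt{q})$ is given by $\{\varepsilon_{p},\ \varepsilon_{q},\ \sqrt{\varepsilon_{pq}}\}$. 2. A fundamental system of units of $\mathbb{Q}(\sqrt{2},\sqrt{q})$ is given by $\{\varepsilon_{2},\ \sqrt{\varepsilon_{q}},\ \sqrt{\varepsilon_{2q}}\}$. 3. A fundamental system of units of $\mathbb{Q}(\sqrt{p},\sqrt{2q})$ is given by $\{\varepsilon_{p},\ \varepsilon_{2q},\ \sqrt{\varepsilon_{2q}\varepsilon_{2pq}}\}$.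 4. A fundamental system of units of $\mathbb{Q}(\sqrt{q},\sqrt{2p})$ is given by $\{\varepsilon_{q},\ \varepsilon_{2p},\ \sqrt{\varepsilon_{2pq}}\}$. 5. A fundamental system of units of $\mathbb{Q}(\sqrt{2},\sqrt{pq})$ is given by $\{\varepsilon_{2},\ \varepsilon_{pq},\ \sqrt{\varepsilon_{pq}\varepsilon_{2pq}}\}$. -/

import Mathlib

open scoped NumberField

/-- A finite family `u` of units of the ring of integers of `K` is a fundamental system of units:
every unit is, in exactly one way, a root of unity of `K` times a product of integer powers of
the members of `u`. -/
def IsFundamentalSystem (K : Type*) [Field K] {r : ℕ} (u : Fin r → (𝓞 K)ˣ) : Prop :=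
  ∀ x : (𝓞 K)ˣ, ∃! ζe : NumberField.Units.torsion K × (Fin r → ℤ),
    x = (ζe.1 : (𝓞 K)ˣ) * ∏ i, u i ^ ζe.2 i

/-- The real numbers `x 0, …, x (r - 1)` are units of (the ring of integers of) the real field `K`
and form a fundamental system of units of `K`. -/
def IsFSU (K : IntermediateField ℚ ℝ) {r : ℕ} (x : Fin r → ℝ) : Prop :=
  ∃ u : Fin r → (𝓞 K)ˣ, (∀ i, (((u i : 𝓞 K) : K) : ℝ) = x i) ∧ IsFundamentalSystem K u

/-- The real quadratic field `ℚ(√d)`, as a subfield of `ℝ`. -/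
noncomputable def quadraticField (d : ℕ) : IntermediateField ℚ ℝ :=
  IntermediateField.adjoin ℚ {√(d : ℝ)}

/-- The field `ℚ(√a, √b)`, as a subfield of `ℝ`. -/
noncomputable def biquadraticField (a b : ℕ) : IntermediateField ℚ ℝ :=
  IntermediateField.adjoin ℚ {√(a : ℝ), √(b : ℝ)}

/-- The fundamental unit `ε_d` of `ℚ(√d)` (for a squarefree `d > 1`): the least unit of its ring of
integers that exceeds `1`. -/
noncomputable def fundamentalUnit (d : ℕ) : ℝ :=
  sInf {x : ℝ | 1 < x ∧ ∃ u : (𝓞 (quadraticField d))ˣ, (((u : 𝓞 (quadraticField d)) :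
    quadraticField d) : ℝ) = x}

/-!
For a positive unit `y` of `ℚ(√a, √b)`, the square `y²` is a quotient of relative norms, hence a
product of powers of `ε_a`, `ε_b`, `ε_ab`. If `ε_a` has norm `-1` and `ε_ab` norm `1`, then applying
the automorphism that moves `√a` and fixes `√b` to that product shows that the exponent of `ε_a` is
even, so only the square roots of `ε_b`, `ε_ab` and `ε_b ε_ab` matter.

Whether these lie in the field is decided in the quadratic subfields. A unit `ε` of norm `1` in
`ℚ(√d)` has trace `n + 2` with `n (n + 4) = d s²`, while `√(n + 4) √ε = ε + 1` and
`√n √ε = ε - 1`. Replacing `n + 4` or `n` by its squarefree part `δ` gives `√δ √ε ∈ ℚ(√d)` for some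
`δ` composed of primes dividing `2 d`. When `p ∣ d`, choosing the factor prime to `p` makes `δ` a
square modulo `p`, and since `2` is not one while `q` is, the factor `2` cannot occur. Finally `δ`
and `δ d` are not squares, for otherwise `√ε` would be a unit of `ℚ(√d)` below `ε`.
-/

lemma isIntegral_coe_intermediateField_iff {E : Type*} [Field E] [Algebra ℚ E]
    {K : IntermediateField ℚ E} {k : K} : IsIntegral ℤ (k : E) ↔ IsIntegral ℤ k :=
  isIntegral_algHom_iff (K.val : K →+* E).toIntAlgHom K.val.injective

/-- `x` is a unit of the ring of integers of the number field `K`, seen inside an ambient field `E`.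
Working with elements of `E` rather than of `(𝓞 K)ˣ` lets one unit belong to several fields. -/
structure IsUnitIn {E : Type*} [Field E] [Algebra ℚ E] (K : IntermediateField ℚ E) (x : E) :
    Prop where
  mem : x ∈ K
  ne_zero : x ≠ 0
  isIntegral : IsIntegral ℤ x
  isIntegral_inv : IsIntegral ℤ x⁻¹

namespace IsUnitIn

variable {E : Type*} [Field E] [Algebra ℚ E] {K L : IntermediateField ℚ E} {x y : E}

lemma one : IsUnitIn K 1 :=
  ⟨one_mem K, one_ne_zero, isIntegral_one, by simpa using isIntegral_one⟩

lemma mul (hx : IsUnitIn K x) (hy : IsUnitIn K y) : IsUnitIn K (x * y) :=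
  ⟨mul_mem hx.mem hy.mem, mul_ne_zero hx.ne_zero hy.ne_zero, hx.isIntegral.mul hy.isIntegral, by
    rw [mul_inv]; exact hx.isIntegral_inv.mul hy.isIntegral_inv⟩

lemma inv (hx : IsUnitIn K x) : IsUnitIn K x⁻¹ :=
  ⟨inv_mem hx.mem, inv_ne_zero hx.ne_zero, hx.isIntegral_inv, by
    rw [inv_inv]; exact hx.isIntegral⟩

lemma neg (hx : IsUnitIn K x) : IsUnitIn K (-x) :=
  ⟨neg_mem hx.mem, neg_ne_zero.2 hx.ne_zero, hx.isIntegral.neg, by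
    rw [inv_neg]; exact hx.isIntegral_inv.neg⟩

lemma abs {x : ℝ} {K : IntermediateField ℚ ℝ} (hx : IsUnitIn K x) : IsUnitIn K |x| := by
  rcases abs_choice x with h | h <;> rw [h]
  exacts [hx, hx.neg]

lemma div (hx : IsUnitIn K x) (hy : IsUnitIn K y) : IsUnitIn K (x / y) := by
  rw [div_eq_mul_inv]; exact hx.mul hy.inv

lemma pow (hx : IsUnitIn K x) : ∀ n : ℕ, IsUnitIn K (x ^ n)
  | 0 => by rw [pow_zero]; exact one
  | n + 1 => by rw [pow_succ]; exact (hx.pow n).mul hx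

lemma zpow (hx : IsUnitIn K x) : ∀ n : ℤ, IsUnitIn K (x ^ n)
  | (n : ℕ) => by rw [zpow_natCast]; exact hx.pow n
  | Int.negSucc n => by rw [zpow_negSucc]; exact (hx.pow _).inv

lemma of_mem (hx : IsUnitIn K x) (hm : x ∈ L) : IsUnitIn L x :=
  ⟨hm, hx.ne_zero, hx.isIntegral, hx.isIntegral_inv⟩

lemma mul_of_mem {M : IntermediateField ℚ E} (hx : IsUnitIn K x) (hy : IsUnitIn L y)
    (hm : x * y ∈ M) : IsUnitIn M (x * y) :=
  ((hx.of_mem IntermediateField.mem_top).mul (hy.of_mem IntermediateField.mem_top)).of_mem hm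

lemma of_sq (hm : x ∈ K) (h : IsUnitIn L (x ^ 2)) : IsUnitIn K x :=
  ⟨hm, fun h0 => h.ne_zero (by rw [h0, sq, mul_zero]), (IsIntegral.pow_iff two_pos).1 h.isIntegral,
    (IsIntegral.pow_iff two_pos).1 (by rw [inv_pow]; exact h.isIntegral_inv)⟩

lemma map {E' : Type*} [Field E'] [Algebra ℚ E'] (σ : K →ₐ[ℚ] E') (hx : IsUnitIn K x) :
    IsUnitIn σ.fieldRange (σ ⟨x, hx.mem⟩) where
  mem := ⟨_, rfl⟩
  ne_zero := (map_ne_zero σ).2 fun h => hx.ne_zero (congrArg Subtype.val h)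
  isIntegral :=
    map_isIntegral_int (σ : K →+* E') (isIntegral_coe_intermediateField_iff.1 hx.isIntegral)
  isIntegral_inv := by
    rw [← map_inv₀]
    exact map_isIntegral_int (σ : K →+* E')
      (isIntegral_coe_intermediateField_iff.1 hx.isIntegral_inv)

end IsUnitIn

lemma isUnitIn_iff_exists_units {E : Type*} [Field E] [Algebra ℚ E] {K : IntermediateField ℚ E}
    {x : E} : IsUnitIn K x ↔ ∃ u : (𝓞 K)ˣ, (((u : 𝓞 K) : K) : E) = x := by
  constructor
  · intro hx
    let k : K := ⟨x, hx.mem⟩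
    have hk : IsIntegral ℤ k := isIntegral_coe_intermediateField_iff.1 hx.isIntegral
    have hk' : IsIntegral ℤ k⁻¹ := isIntegral_coe_intermediateField_iff.1 hx.isIntegral_inv
    have hk0 : k ≠ 0 := fun h => hx.ne_zero (congrArg Subtype.val h)
    exact ⟨⟨⟨k, hk⟩, ⟨k⁻¹, hk'⟩, NumberField.RingOfIntegers.ext (mul_inv_cancel₀ hk0),
      NumberField.RingOfIntegers.ext (inv_mul_cancel₀ hk0)⟩, rfl⟩
  · rintro ⟨u, rfl⟩
    have hinv : ((((u⁻¹ : (𝓞 K)ˣ) : 𝓞 K) : K) : E) = (((u : 𝓞 K) : K) : E)⁻¹ := by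
      apply eq_inv_of_mul_eq_one_left
      norm_cast
      simp
    refine ⟨SetLike.coe_mem _, by simp,
      isIntegral_coe_intermediateField_iff.2 (NumberField.RingOfIntegers.isIntegral_coe _), ?_⟩
    rw [← hinv]
    exact isIntegral_coe_intermediateField_iff.2 (NumberField.RingOfIntegers.isIntegral_coe _)

lemma exists_intCast_eq_of_isIntegral {E : Type*} [Field E] [Algebra ℚ E] {x : E}
    (hx : IsIntegral ℤ x) (hm : x ∈ (⊥ : IntermediateField ℚ E)) : ∃ n : ℤ, (n : E) = x := by
  obtain ⟨r, rfl⟩ := IntermediateField.mem_bot.1 hm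
  have hr : IsIntegral ℤ r :=
    (isIntegral_algHom_iff (algebraMap ℚ E).toIntAlgHom (algebraMap ℚ E).injective).1 hx
  obtain ⟨n, rfl⟩ := IsIntegrallyClosed.isIntegral_iff.1 hr
  exact ⟨n, by simp⟩

lemma IsUnitIn.eq_one_or_eq_neg_one {E : Type*} [Field E] [Algebra ℚ E] {x : E}
    (hx : IsUnitIn (⊥ : IntermediateField ℚ E) x) : x = 1 ∨ x = -1 := by
  obtain ⟨m, hm⟩ := exists_intCast_eq_of_isIntegral hx.isIntegral hx.mem
  obtain ⟨n, hn⟩ := exists_intCast_eq_of_isIntegral hx.isIntegral_inv hx.inv.mem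
  have : CharZero E := algebraRat.charZero E
  have hmn : m * n = 1 := by
    exact_mod_cast (show (m : E) * n = 1 by rw [hm, hn, mul_inv_cancel₀ hx.ne_zero])
  rcases Int.eq_one_or_neg_one_of_mul_eq_one hmn with rfl | rfl <;> simp [← hm]

section PositiveUnits

variable {K : IntermediateField ℚ ℝ}

/-- The real value of a unit of a real field, as a group homomorphism. -/
noncomputable def unitValue (K : IntermediateField ℚ ℝ) : (𝓞 K)ˣ →* ℝˣ :=
  Units.map ((K.val : K →+* ℝ).comp (algebraMap (𝓞 K) K) : 𝓞 K →* ℝ)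

lemma unitValue_apply (u : (𝓞 K)ˣ) : (unitValue K u : ℝ) = ((u : 𝓞 K) : K) := rfl

lemma unitValue_injective : Function.Injective (unitValue K) := fun _ _ h =>
  Units.ext (NumberField.RingOfIntegers.ext (Subtype.ext (congrArg Units.val h)))

lemma isUnitIn_unitValue (u : (𝓞 K)ˣ) : IsUnitIn K (unitValue K u : ℝ) :=
  isUnitIn_iff_exists_units.2 ⟨u, rfl⟩

lemma unitValue_prod_zpow {r : ℕ} {u : Fin r → (𝓞 K)ˣ} {x : Fin r → ℝ}
    (hu : ∀ i, (((u i : 𝓞 K) : K) : ℝ) = x i) (n : Fin r → ℤ) :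
    (unitValue K (∏ i, u i ^ n i) : ℝ) = ∏ i, x i ^ n i := by
  simp [map_prod, unitValue_apply, hu]

lemma abs_unitValue_of_mem_torsion {ζ : (𝓞 K)ˣ} (hζ : ζ ∈ NumberField.Units.torsion K) :
    |(unitValue K ζ : ℝ)| = 1 := by
  obtain ⟨n, hn, h⟩ := isOfFinOrder_iff_pow_eq_one.1 hζ
  refine (pow_eq_one_iff_of_nonneg (abs_nonneg _) hn.ne').1 ?_
  rw [← abs_pow, ← Units.val_pow_eq_pow_val, ← map_pow, h, map_one, Units.val_one, abs_one]

lemma exists_torsion_mul_of_abs_eq {y v : (𝓞 K)ˣ}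
    (h : |(unitValue K y : ℝ)| = |(unitValue K v : ℝ)|) :
    ∃ ζ : NumberField.Units.torsion K, y = ζ * v := by
  have hneg : (-1 : (𝓞 K)ˣ) ∈ NumberField.Units.torsion K :=
    isOfFinOrder_iff_pow_eq_one.2 ⟨2, two_pos, by simp⟩
  rcases abs_eq_abs.1 h with h | h
  · exact ⟨1, by rw [OneMemClass.coe_one, one_mul]; exact unitValue_injective (Units.ext h)⟩
  · refine ⟨⟨-1, hneg⟩, unitValue_injective (Units.ext ?_)⟩
    simpa [unitValue_apply] using h

/-- A real field has no roots of unity besides `±1`, so only the positive units matter. -/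
theorem isFSU_of_pos {r : ℕ} {x : Fin r → ℝ} (hx : ∀ i, IsUnitIn K (x i)) (hpos : ∀ i, 0 < x i)
    (hgen : ∀ y, IsUnitIn K y → 0 < y → ∃ n : Fin r → ℤ, y = ∏ i, x i ^ n i)
    (hind : ∀ n : Fin r → ℤ, ∏ i, x i ^ n i = 1 → n = 0) : IsFSU K x := by
  choose u hu using fun i => isUnitIn_iff_exists_units.1 (hx i)
  have hprod_pos (n : Fin r → ℤ) : 0 < ∏ i, x i ^ n i :=
    Finset.prod_pos fun i _ => zpow_pos (hpos i) _
  refine ⟨u, hu, fun y => ?_⟩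
  have hy := isUnitIn_unitValue y
  obtain ⟨n, hn⟩ := hgen _ (hy.abs) (abs_pos.2 hy.ne_zero)
  obtain ⟨ζ, hζ⟩ := exists_torsion_mul_of_abs_eq (y := y) (v := ∏ i, u i ^ n i) (by
    rw [unitValue_prod_zpow hu, ← hn, abs_abs])
  refine ⟨(ζ, n), hζ, ?_⟩
  rintro ⟨ζ', n'⟩ hζ'
  have hn' : |(unitValue K y : ℝ)| = ∏ i, x i ^ n' i := by
    rw [hζ', map_mul, Units.val_mul, abs_mul, abs_unitValue_of_mem_torsion ζ'.2, one_mul,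
      unitValue_prod_zpow hu, abs_of_pos (hprod_pos n')]
  have hdiff : ∏ i, x i ^ (n' - n) i = 1 := by
    simp only [Pi.sub_apply, zpow_sub₀ (hpos _).ne', Finset.prod_div_distrib]
    rw [← hn, ← hn', div_self (abs_ne_zero.2 hy.ne_zero)]
  obtain rfl : n' = n := sub_eq_zero.1 (hind _ hdiff)
  exact Prod.ext (Subtype.ext (mul_right_cancel (hζ'.symm.trans hζ))) rfl

lemma isFSU_three {x₁ x₂ x₃ : ℝ} (h₁ : IsUnitIn K x₁) (h₂ : IsUnitIn K x₂) (h₃ : IsUnitIn K x₃)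
    (p₁ : 0 < x₁) (p₂ : 0 < x₂) (p₃ : 0 < x₃)
    (hgen : ∀ y, IsUnitIn K y → 0 < y → ∃ A B C : ℤ, y = x₁ ^ A * x₂ ^ B * x₃ ^ C)
    (hind : ∀ A B C : ℤ, x₁ ^ A * x₂ ^ B * x₃ ^ C = 1 → A = 0 ∧ B = 0 ∧ C = 0) :
    IsFSU K ![x₁, x₂, x₃] := by
  refine isFSU_of_pos (by simp [Fin.forall_fin_succ, *]) (by simp [Fin.forall_fin_succ, *])
    (fun y hy hpos => ?_) (fun n hn => ?_)
  · obtain ⟨A, B, C, h⟩ := hgen y hy hpos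
    exact ⟨![A, B, C], by simp [Fin.prod_univ_three, h]⟩
  · obtain ⟨h0, h1, h2⟩ := hind (n 0) (n 1) (n 2) (by simpa [Fin.prod_univ_three] using hn)
    ext i
    fin_cases i <;> assumption

lemma IsFSU.comp_perm {r : ℕ} {x : Fin r → ℝ} (h : IsFSU K x) (σ : Equiv.Perm (Fin r)) :
    IsFSU K (x ∘ σ) := by
  obtain ⟨u, hu, hfs⟩ := h
  refine ⟨u ∘ σ, fun i => hu (σ i), fun y => ?_⟩
  let e : NumberField.Units.torsion K × (Fin r → ℤ) ≃ NumberField.Units.torsion K × (Fin r → ℤ) :=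
    (Equiv.refl _).prodCongr (Equiv.arrowCongr σ (Equiv.refl ℤ))
  refine (e.existsUnique_congr fun {ζn} => ?_).2 (hfs y)
  have hprod : ∏ i, u i ^ (e ζn).2 i = ∏ i, (u ∘ σ) i ^ ζn.2 i :=
    (Equiv.prod_comp σ _).symm.trans (by simp [e])
  rw [hprod]
  rfl

end PositiveUnits

section AdjoinSqrt

open Polynomial
open IntermediateField hiding algebraMap_mem

variable {F E : Type*} [Field F] [Field E] [Algebra F E] {c : F} {γ x : E}

lemma exists_add_mul_of_mem_adjoin_sqrt (hγ : γ ^ 2 = algebraMap F E c) (hx : x ∈ F⟮γ⟯) :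
    ∃ α β : F, x = algebraMap F E α + algebraMap F E β * γ := by
  have hint : IsIntegral F γ := (IsIntegral.pow_iff two_pos).1 (hγ ▸ isIntegral_algebraMap)
  rw [← mem_toSubalgebra, adjoin_simple_toSubalgebra_of_isAlgebraic hint.isAlgebraic,
    Algebra.adjoin_singleton_eq_range_aeval] at hx
  obtain ⟨f, rfl⟩ := hx
  have hmonic : (X ^ 2 - C c).Monic := monic_X_pow_sub_C c two_ne_zero
  obtain ⟨β, α, hf⟩ := exists_eq_X_add_C_of_natDegree_le_one (p := f %ₘ (X ^ 2 - C c)) (by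
    have := natDegree_modByMonic_lt f hmonic fun h => by simpa using congrArg natDegree h
    rw [natDegree_X_pow_sub_C] at this
    omega)
  refine ⟨α, β, ?_⟩
  change aeval γ f = _
  rw [← aeval_modByMonic_eq_self_of_root (q := X ^ 2 - C c) (by simp [hγ]), hf]
  simp [add_comm]

lemma exists_algHom_adjoin_sqrt_eq_neg (hγ : γ ^ 2 = algebraMap F E c)
    (hγF : γ ∉ (⊥ : IntermediateField F E)) :
    ∃ σ : F⟮γ⟯ →ₐ[F] E, σ (AdjoinSimple.gen F γ) = -γ := by
  have hirr : Irreducible (X ^ 2 - C c) := by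
    refine X_pow_sub_C_irreducible_of_prime Nat.prime_two fun b hb => hγF ?_
    rcases sq_eq_sq_iff_eq_or_eq_neg.1 (show γ ^ 2 = algebraMap F E b ^ 2 by
      rw [hγ, ← map_pow, hb]) with h | h
    · exact h ▸ algebraMap_mem _ b
    · exact h ▸ neg_mem (algebraMap_mem _ b)
  have hroot {y : E} (hy : y ^ 2 = algebraMap F E c) : aeval y (X ^ 2 - C c) = 0 := by
    simp [hy]
  have hmonic : (X ^ 2 - C c).Monic := monic_X_pow_sub_C c two_ne_zero
  have hmin : X ^ 2 - C c = minpoly F γ :=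
    minpoly.eq_of_irreducible_of_monic hirr (hroot hγ) hmonic
  have hmem : -γ ∈ (minpoly F γ).aroots E := by
    rw [← hmin, mem_aroots]
    exact ⟨hirr.ne_zero, hroot (by rw [neg_sq, hγ])⟩
  have hint : IsIntegral F γ := ⟨_, hmonic, hroot hγ⟩
  exact ⟨_, algHomAdjoinIntegralEquiv_symm_apply_gen F hint ⟨_, hmem⟩⟩

lemma mem_bot_or_mul_mem_bot_of_sq_mem [NeZero (2 : F)] (hγ : γ ^ 2 = algebraMap F E c)
    (hx : x ∈ F⟮γ⟯) (hx2 : x ^ 2 ∈ (⊥ : IntermediateField F E)) :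
    x ∈ (⊥ : IntermediateField F E) ∨ x * γ ∈ (⊥ : IntermediateField F E) := by
  obtain ⟨α, β, rfl⟩ := exists_add_mul_of_mem_adjoin_sqrt hγ hx
  have hmem (z : F) : algebraMap F E z ∈ (⊥ : IntermediateField F E) := algebraMap_mem _ z
  rcases eq_or_ne β 0 with rfl | hβ
  · left; simp [hmem]
  rcases eq_or_ne α 0 with rfl | hα
  · right
    rw [map_zero, zero_add, mul_assoc, ← sq, hγ]
    exact mul_mem (hmem β) (hmem c)
  left
  have hne : algebraMap F E (2 * α * β) ≠ 0 :=
    (_root_.map_ne_zero _).2 (mul_ne_zero (mul_ne_zero two_ne_zero hα) hβ)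
  have hγ_eq : γ = ((algebraMap F E α + algebraMap F E β * γ) ^ 2 -
      algebraMap F E (α ^ 2 + β ^ 2 * c)) / algebraMap F E (2 * α * β) := by
    rw [eq_div_iff hne]
    simp only [map_mul, map_add, map_pow, map_ofNat]
    linear_combination (-(algebraMap F E β) ^ 2) * hγ
  have hγ_mem : γ ∈ (⊥ : IntermediateField F E) :=
    hγ_eq ▸ div_mem (sub_mem hx2 (hmem _)) (hmem _)
  exact add_mem (hmem α) (mul_mem (hmem β) hγ_mem)

end AdjoinSqrt

section RealFields

open IntermediateField

variable {a b c d : ℕ} {x : ℝ}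

lemma sq_sqrt_natCast (d : ℕ) : √(d : ℝ) ^ 2 = d := Real.sq_sqrt (Nat.cast_nonneg d)

lemma sqrt_natCast_mul (a b : ℕ) : √((a * b : ℕ) : ℝ) = √(a : ℝ) * √(b : ℝ) := by
  rw [Nat.cast_mul, Real.sqrt_mul (Nat.cast_nonneg a)]

lemma sqrt_mem_quadraticField (d : ℕ) : √(d : ℝ) ∈ quadraticField d :=
  subset_adjoin _ _ rfl

lemma quadraticField_le {K : IntermediateField ℚ ℝ} (h : √(d : ℝ) ∈ K) : quadraticField d ≤ K :=
  adjoin_le_iff.2 (by simpa using h)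

lemma sqrt_mem_biquadraticField_left (a b : ℕ) : √(a : ℝ) ∈ biquadraticField a b :=
  subset_adjoin _ _ (by simp)

lemma sqrt_mem_biquadraticField_right (a b : ℕ) : √(b : ℝ) ∈ biquadraticField a b :=
  subset_adjoin _ _ (by simp)

lemma sqrt_mul_mem_biquadraticField (a b : ℕ) : √((a * b : ℕ) : ℝ) ∈ biquadraticField a b := by
  rw [sqrt_natCast_mul]
  exact mul_mem (sqrt_mem_biquadraticField_left a b) (sqrt_mem_biquadraticField_right a b)

lemma biquadraticField_comm (a b : ℕ) : biquadraticField a b = biquadraticField b a := by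
  rw [biquadraticField, biquadraticField, Set.pair_comm]

lemma restrictScalars_adjoin_quadraticField (a b : ℕ) :
    (quadraticField a)⟮√(b : ℝ)⟯.restrictScalars ℚ = biquadraticField a b :=
  adjoin_simple_adjoin_simple ℚ √(a : ℝ) √(b : ℝ)

lemma mem_adjoin_of_mem_biquadraticField (hx : x ∈ biquadraticField a b) :
    x ∈ (quadraticField a)⟮√(b : ℝ)⟯ := by
  rwa [← restrictScalars_adjoin_quadraticField] at hx

lemma exists_coords_of_mem_quadraticField (hx : x ∈ quadraticField d) :
    ∃ r s : ℚ, x = r + s * √(d : ℝ) :=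
  exists_add_mul_of_mem_adjoin_sqrt (c := (d : ℚ)) (by simp) hx

lemma exists_coords_of_mem_biquadraticField (hx : x ∈ biquadraticField a b) :
    ∃ r s t u : ℚ, x = r + s * √(a : ℝ) + (t + u * √(a : ℝ)) * √(b : ℝ) := by
  obtain ⟨⟨_, hα⟩, ⟨_, hβ⟩, rfl⟩ := exists_add_mul_of_mem_adjoin_sqrt
    (c := (b : quadraticField a)) (by simp) (mem_adjoin_of_mem_biquadraticField hx)
  obtain ⟨r, s, rfl⟩ := exists_coords_of_mem_quadraticField hα
  obtain ⟨t, u, rfl⟩ := exists_coords_of_mem_quadraticField hβ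
  exact ⟨r, s, t, u, rfl⟩

lemma isSquare_of_sqrt_natCast_mem_bot {n : ℕ} (h : √(n : ℝ) ∈ (⊥ : IntermediateField ℚ ℝ)) :
    IsSquare n := by
  obtain ⟨r, hr⟩ := mem_bot.1 h
  by_contra hn
  exact irrational_sqrt_natCast_iff.2 hn ⟨r, hr⟩

lemma isSquare_or_isSquare_mul_of_sqrt_mem_quadraticField (h : √(c : ℝ) ∈ quadraticField a) :
    IsSquare c ∨ IsSquare (c * a) := by
  refine (mem_bot_or_mul_mem_bot_of_sq_mem (c := (a : ℚ)) (by simp) h ?_).imp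
    isSquare_of_sqrt_natCast_mem_bot fun h => isSquare_of_sqrt_natCast_mem_bot ?_
  · rw [sq_sqrt_natCast]; exact _root_.natCast_mem _ c
  · rwa [sqrt_natCast_mul]

lemma isSquare_or_of_sqrt_mem_biquadraticField (h : √(c : ℝ) ∈ biquadraticField a b) :
    IsSquare c ∨ IsSquare (c * a) ∨ IsSquare (c * b) ∨ IsSquare (c * b * a) := by
  have hbot {y : ℝ} (hy : y ∈ (⊥ : IntermediateField (quadraticField a) ℝ)) :
      y ∈ quadraticField a := by
    obtain ⟨k, rfl⟩ := mem_bot.1 hy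
    exact k.2
  rcases mem_bot_or_mul_mem_bot_of_sq_mem (c := (b : quadraticField a)) (by simp)
    (mem_adjoin_of_mem_biquadraticField h) (by
      rw [sq_sqrt_natCast]; exact _root_.natCast_mem _ c) with h | h
  · exact (isSquare_or_isSquare_mul_of_sqrt_mem_quadraticField (hbot h)).imp_right Or.inl
  · rw [← sqrt_natCast_mul] at h
    exact Or.inr (Or.inr (isSquare_or_isSquare_mul_of_sqrt_mem_quadraticField (hbot h)))

lemma not_isSquare_of_squarefree {n : ℕ} (hn : Squarefree n) (h1 : n ≠ 1) : ¬IsSquare n := by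
  rintro ⟨m, rfl⟩
  exact h1 (by rw [Nat.isUnit_iff.1 (hn m dvd_rfl)])

lemma isSquare_of_isSquare_sq_mul {n m : ℕ} (hn : n ≠ 0) (h : IsSquare (n ^ 2 * m)) :
    IsSquare m := by
  obtain ⟨k, hk⟩ := h
  obtain ⟨l, rfl⟩ := (Nat.pow_dvd_pow_iff two_ne_zero).1 (Dvd.intro m (hk.trans (sq k).symm))
  exact ⟨l, Nat.eq_of_mul_eq_mul_left (pow_pos hn.bot_lt 2) (by rw [hk]; ring)⟩

lemma not_isSquare_mul_of_squarefree {m n : ℕ} (h : Squarefree (m * n)) (hm : m ≠ 1) :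
    ¬IsSquare (m * n) :=
  not_isSquare_of_squarefree h fun h1 => hm (Nat.eq_one_of_mul_eq_one_right h1)

lemma sqrt_notMem_biquadraticField (hsf : Squarefree (a * b * c)) (hc : c ≠ 1) :
    √(c : ℝ) ∉ biquadraticField a b := by
  have hnot {m : ℕ} (h : c * m ∣ a * b * c) : ¬IsSquare (c * m) :=
    not_isSquare_mul_of_squarefree (hsf.squarefree_of_dvd h) hc
  intro h
  rcases isSquare_or_of_sqrt_mem_biquadraticField h with h | h | h | h
  · exact hnot (m := 1) ⟨a * b, by ring⟩ (by rwa [mul_one])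
  · exact hnot ⟨b, by ring⟩ h
  · exact hnot ⟨a, by ring⟩ h
  · exact hnot (m := b * a) ⟨1, by ring⟩ (by rwa [mul_assoc] at h)

lemma sqrt_notMem_biquadraticField_mul (hsf : Squarefree (a * b * c)) (ha : a ≠ 1) (hb : b ≠ 1) :
    √(a : ℝ) ∉ biquadraticField c (a * b) := by
  have hnot {m n : ℕ} (hm : m ≠ 1) (h : m * n ∣ a * b * c) : ¬IsSquare (m * n) :=
    not_isSquare_mul_of_squarefree (hsf.squarefree_of_dvd h) hm
  have ha0 : a ≠ 0 := by rintro rfl; simp at hsf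
  intro h
  rcases isSquare_or_of_sqrt_mem_biquadraticField h with h | h | h | h
  · exact hnot (n := 1) ha ⟨b * c, by ring⟩ (by rwa [mul_one])
  · exact hnot ha ⟨b, by ring⟩ h
  · exact hnot (n := 1) hb ⟨a * c, by ring⟩
      (isSquare_of_isSquare_sq_mul ha0 (by convert h using 1; ring))
  · exact hnot hb ⟨a, by ring⟩
      (isSquare_of_isSquare_sq_mul (m := b * c) ha0 (by convert h using 1; ring))

end RealFields

section QuadraticUnits

variable {K : IntermediateField ℚ ℝ} {d : ℕ} {n : ℤ} {x : ℝ}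

/-- The element `x` of `ℚ(√d)` has norm `n` over `ℚ`. -/
def HasNorm (d : ℕ) (x : ℝ) (n : ℤ) : Prop :=
  ∃ r s : ℚ, x = r + s * √(d : ℝ) ∧ r ^ 2 - d * s ^ 2 = n

lemma exists_conj_quadraticField (hd : ¬IsSquare d) :
    ∃ σ : quadraticField d →ₐ[ℚ] ℝ, σ ⟨_, sqrt_mem_quadraticField d⟩ = -√(d : ℝ) :=
  exists_algHom_adjoin_sqrt_eq_neg (c := (d : ℚ)) (by simp) (mt isSquare_of_sqrt_natCast_mem_bot hd)

lemma map_add_mul_sqrt (σ : K →ₐ[ℚ] ℝ) (hm : √(d : ℝ) ∈ K) {r s : ℚ}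
    (hx : (r + s * √(d : ℝ) : ℝ) ∈ K) :
    σ ⟨_, hx⟩ = r + s * σ ⟨_, hm⟩ := by
  have hk : (⟨_, hx⟩ : K) = (r : K) + (s : K) * ⟨_, hm⟩ := Subtype.ext (by simp)
  rw [hk, map_add, map_mul, map_ratCast, map_ratCast]

lemma add_mul_sub_mul_sqrt (r s : ℚ) (d : ℕ) :
    (r + s * √(d : ℝ)) * (r - s * √(d : ℝ)) = ((r ^ 2 - d * s ^ 2 : ℚ) : ℝ) := by
  push_cast
  linear_combination (-(s : ℝ) ^ 2) * sq_sqrt_natCast d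

lemma mul_inv_eq_sub_mul_sqrt (hx0 : x ≠ 0) {r s : ℚ} (hx : x = r + s * √(d : ℝ))
    (hn : r ^ 2 - d * s ^ 2 = n) : n * x⁻¹ = r - s * √(d : ℝ) := by
  rw [mul_inv_eq_iff_eq_mul₀ hx0, mul_comm, hx, add_mul_sub_mul_sqrt, hn, Rat.cast_intCast]

lemma mul_map_add_mul_sqrt {σ : K →ₐ[ℚ] ℝ} (hm : √(d : ℝ) ∈ K) (hσ : σ ⟨_, hm⟩ = -√(d : ℝ))
    {r s : ℚ} (hx : (r + s * √(d : ℝ) : ℝ) ∈ K) :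
    (r + s * √(d : ℝ)) * σ ⟨_, hx⟩ = ((r ^ 2 - d * s ^ 2 : ℚ) : ℝ) := by
  rw [map_add_mul_sqrt σ hm, hσ, mul_neg, ← sub_eq_add_neg, add_mul_sub_mul_sqrt]

lemma HasNorm.mul_map (h : HasNorm d x n) {σ : K →ₐ[ℚ] ℝ} (hm : √(d : ℝ) ∈ K)
    (hσ : σ ⟨_, hm⟩ = -√(d : ℝ)) (hx : x ∈ K) : x * σ ⟨x, hx⟩ = n := by
  obtain ⟨r, s, rfl, h⟩ := h
  rw [mul_map_add_mul_sqrt hm hσ, h, Rat.cast_intCast]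

lemma IsUnitIn.hasNorm_one_or_neg_one (hd : ¬IsSquare d) (hx : IsUnitIn (quadraticField d) x) :
    HasNorm d x 1 ∨ HasNorm d x (-1) := by
  obtain ⟨σ, hσ⟩ := exists_conj_quadraticField hd
  obtain ⟨r, s, rfl⟩ := exists_coords_of_mem_quadraticField hx.mem
  have hunit : IsUnitIn (⊥ : IntermediateField ℚ ℝ) ((r ^ 2 - d * s ^ 2 : ℚ) : ℝ) := by
    rw [← mul_map_add_mul_sqrt (sqrt_mem_quadraticField d) hσ hx.mem]
    refine hx.mul_of_mem (hx.map σ) ?_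
    rw [mul_map_add_mul_sqrt (sqrt_mem_quadraticField d) hσ hx.mem]
    exact IntermediateField.algebraMap_mem ⊥ (r ^ 2 - d * s ^ 2)
  refine hunit.eq_one_or_eq_neg_one.imp (fun h => ⟨r, s, rfl, ?_⟩) (fun h => ⟨r, s, rfl, ?_⟩) <;>
    exact_mod_cast h

lemma IsUnitIn.exists_intCast_eq_trace (hx : IsUnitIn K x) (h : HasNorm d x n) :
    ∃ t : ℤ, x + n * x⁻¹ = t := by
  obtain ⟨r, s, hxrs, hn⟩ := h
  have hrat : x + n * x⁻¹ = algebraMap ℚ ℝ (2 * r) := by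
    rw [mul_inv_eq_sub_mul_sqrt hx.ne_zero hxrs hn, hxrs, eq_ratCast]; push_cast; ring
  obtain ⟨t, ht⟩ := exists_intCast_eq_of_isIntegral
    (hx.isIntegral.add ((isIntegral_algebraMap (x := n)).mul hx.isIntegral_inv))
    (hrat ▸ IntermediateField.algebraMap_mem ⊥ _ : x + algebraMap ℤ ℝ n * x⁻¹ ∈ _)
  exact ⟨t, ht.symm⟩

lemma isUnitIn_of_sq_sub_mul_sq_eq_one {a b : ℤ} (h : a ^ 2 - d * b ^ 2 = 1) :
    IsUnitIn (quadraticField d) (a + b * √(d : ℝ)) := by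
  have hz (m : ℤ) : IsIntegral ℤ (m : ℝ) := isIntegral_algebraMap (R := ℤ) (x := m)
  have hsqrt : IsIntegral ℤ √(d : ℝ) :=
    (IsIntegral.pow_iff two_pos).1 (by rw [sq_sqrt_natCast]; exact_mod_cast hz d)
  have hinv : (a + b * √(d : ℝ)) * (a - b * √(d : ℝ)) = 1 := by
    have := add_mul_sub_mul_sqrt a b d
    have hQ : (a ^ 2 - d * b ^ 2 : ℚ) = 1 := mod_cast h
    simpa [hQ] using this
  refine ⟨add_mem (intCast_mem _ a) (mul_mem (intCast_mem _ b) (sqrt_mem_quadraticField d)),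
    left_ne_zero_of_mul_eq_one hinv, (hz a).add ((hz b).mul hsqrt), ?_⟩
  rw [inv_eq_of_mul_eq_one_right hinv]
  exact (hz a).sub ((hz b).mul hsqrt)

lemma exists_one_lt_isUnitIn (hd : ¬IsSquare d) : ∃ x, 1 < x ∧ IsUnitIn (quadraticField d) x := by
  obtain ⟨v, hx, hy⟩ := Pell.Solution₁.exists_pos_of_not_isSquare (d := d)
    (by rcases d.eq_zero_or_pos with rfl | h
        exacts [absurd ⟨0, rfl⟩ hd, by exact_mod_cast h])
    (fun h => hd (by exact_mod_cast h))
  refine ⟨_, ?_, isUnitIn_of_sq_sub_mul_sq_eq_one v.prop⟩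
  have hx' : (1 : ℝ) < v.x := mod_cast hx
  have hy' : (0 : ℝ) < v.y := mod_cast hy
  exact lt_add_of_lt_of_nonneg hx' (mul_nonneg hy'.le (Real.sqrt_nonneg _))

/-- Such a unit is the larger root of `X² - tX ± 1` with `0 ≤ t ≤ M + 1`. -/
lemma finite_isUnitIn_Ioc (hd : ¬IsSquare d) (M : ℝ) :
    {x : ℝ | (1 < x ∧ IsUnitIn (quadraticField d) x) ∧ x ≤ M}.Finite := by
  refine ((Set.finite_Icc 0 (⌈M⌉ + 1)).image2
    (fun (t n : ℤ) => ((t : ℝ) + √((t : ℝ) ^ 2 - 4 * n)) / 2)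
    (Set.toFinite {1, -1})).subset ?_
  rintro x ⟨⟨h1, hx⟩, hM⟩
  obtain ⟨n, hn, hnorm⟩ : ∃ n : ℤ, (n = 1 ∨ n = -1) ∧ HasNorm d x n :=
    (hx.hasNorm_one_or_neg_one hd).elim (⟨1, .inl rfl, ·⟩) (⟨-1, .inr rfl, ·⟩)
  obtain ⟨t, ht⟩ := hx.exists_intCast_eq_trace hnorm
  have hinv : |n * x⁻¹| < 1 := by
    have hn1 : |(n : ℝ)| = 1 := by rcases hn with rfl | rfl <;> simp
    rw [abs_mul, hn1, one_mul, abs_of_pos (by positivity)]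
    exact inv_lt_one_of_one_lt₀ h1
  obtain ⟨hlo, hhi⟩ := abs_lt.1 hinv
  have hdisc : (t : ℝ) ^ 2 - 4 * n = (x - n * x⁻¹) ^ 2 := by
    rw [← ht]
    linear_combination (4 * n) * mul_inv_cancel₀ hx.ne_zero
  refine ⟨t, ⟨?_, ?_⟩, n, hn, ?_⟩
  · exact_mod_cast (by linarith : (0 : ℝ) ≤ t)
  · exact_mod_cast (by linarith [Int.le_ceil M] : (t : ℝ) ≤ ⌈M⌉ + 1)
  · simp only [hdisc]
    rw [Real.sqrt_sq (by linarith), ← ht]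
    ring

lemma isLeast_fundamentalUnit (hd : ¬IsSquare d) :
    IsLeast {x : ℝ | 1 < x ∧ IsUnitIn (quadraticField d) x} (fundamentalUnit d) := by
  obtain ⟨y, hy⟩ := exists_one_lt_isUnitIn hd
  obtain ⟨e, ⟨he, hey⟩, hmin⟩ := Set.exists_min_image _ id (finite_isUnitIn_Ioc hd y)
    ⟨y, hy, le_rfl⟩
  have hleast : IsLeast {x : ℝ | 1 < x ∧ IsUnitIn (quadraticField d) x} e :=
    ⟨he, fun x hx => (le_total x y).elim (fun h => hmin x ⟨hx, h⟩) hey.trans⟩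
  simp only [fundamentalUnit, ← isUnitIn_iff_exists_units]
  rwa [hleast.csInf_eq]

lemma one_lt_fundamentalUnit (hd : ¬IsSquare d) : 1 < fundamentalUnit d :=
  (isLeast_fundamentalUnit hd).1.1

lemma fundamentalUnit_pos (hd : ¬IsSquare d) : 0 < fundamentalUnit d :=
  one_pos.trans (one_lt_fundamentalUnit hd)

lemma isUnitIn_fundamentalUnit (hd : ¬IsSquare d) :
    IsUnitIn (quadraticField d) (fundamentalUnit d) :=
  (isLeast_fundamentalUnit hd).1.2

lemma exists_abs_eq_fundamentalUnit_zpow (hd : ¬IsSquare d) (hx : IsUnitIn (quadraticField d) x) :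
    ∃ k : ℤ, |x| = fundamentalUnit d ^ k := by
  have hε := fundamentalUnit_pos hd
  obtain ⟨k, hle, hlt⟩ := exists_mem_Ico_zpow (abs_pos.2 hx.ne_zero) (one_lt_fundamentalUnit hd)
  refine ⟨k, hle.antisymm' (not_lt.1 fun h => hlt.not_ge ?_)⟩
  have hquot : fundamentalUnit d ≤ |x| / fundamentalUnit d ^ k :=
    (isLeast_fundamentalUnit hd).2 ⟨(one_lt_div (zpow_pos hε k)).2 h,
      hx.abs.div ((isUnitIn_fundamentalUnit hd).zpow k)⟩
  rwa [le_div_iff₀ (zpow_pos hε k), ← zpow_one_add₀ hε.ne', add_comm] at hquot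

lemma sqrt_fundamentalUnit_notMem (hd : ¬IsSquare d) :
    √(fundamentalUnit d) ∉ quadraticField d := by
  intro hm
  have hsq : √(fundamentalUnit d) ^ 2 = fundamentalUnit d :=
    Real.sq_sqrt (fundamentalUnit_pos hd).le
  have h1 : 1 < √(fundamentalUnit d) :=
    (Real.lt_sqrt zero_le_one).2 (by simpa using one_lt_fundamentalUnit hd)
  have hle := (isLeast_fundamentalUnit hd).2
    ⟨h1, .of_sq hm (hsq.symm ▸ isUnitIn_fundamentalUnit hd)⟩
  nlinarith

end QuadraticUnits

section BiquadraticUnits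

open IntermediateField

variable {K : IntermediateField ℚ ℝ} {a b d : ℕ} {x y e₁ e₂ e₃ : ℝ}

lemma exists_conj_biquadraticField_right (hb : ¬IsSquare b) (hab : ¬IsSquare (a * b)) :
    ∃ σ : biquadraticField a b →ₐ[ℚ] ℝ,
      σ ⟨_, sqrt_mem_biquadraticField_left a b⟩ = √(a : ℝ) ∧
      σ ⟨_, sqrt_mem_biquadraticField_right a b⟩ = -√(b : ℝ) := by
  obtain ⟨σ, hσ⟩ := exists_algHom_adjoin_sqrt_eq_neg (F := quadraticField a)
    (c := (b : quadraticField a)) (γ := √(b : ℝ)) (by simp) (by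
      rintro ⟨k, hk⟩
      refine (isSquare_or_isSquare_mul_of_sqrt_mem_quadraticField (a := a) (c := b)
        (hk ▸ k.2)).elim hb fun h => hab (by rwa [mul_comm]))
  exact ⟨(σ.restrictScalars ℚ).comp (inclusion (restrictScalars_adjoin_quadraticField a b).ge),
    σ.commutes ⟨_, sqrt_mem_quadraticField a⟩, hσ⟩

lemma exists_conj_biquadraticField_left (ha : ¬IsSquare a) (hab : ¬IsSquare (a * b)) :
    ∃ σ : biquadraticField a b →ₐ[ℚ] ℝ,
      σ ⟨_, sqrt_mem_biquadraticField_left a b⟩ = -√(a : ℝ) ∧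
      σ ⟨_, sqrt_mem_biquadraticField_right a b⟩ = √(b : ℝ) := by
  obtain ⟨σ, hfix, hneg⟩ := exists_conj_biquadraticField_right ha (mul_comm a b ▸ hab)
  exact ⟨σ.comp (inclusion (biquadraticField_comm a b).le), hneg, hfix⟩

lemma map_sqrt_mul (σ : biquadraticField a b →ₐ[ℚ] ℝ) :
    σ ⟨_, sqrt_mul_mem_biquadraticField a b⟩ =
      σ ⟨_, sqrt_mem_biquadraticField_left a b⟩ * σ ⟨_, sqrt_mem_biquadraticField_right a b⟩ := by
  rw [← map_mul]
  exact congrArg σ (Subtype.ext (sqrt_natCast_mul a b))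

lemma map_coords (σ : biquadraticField a b →ₐ[ℚ] ℝ) {r s t u : ℚ}
    (hx : (r + s * √(a : ℝ) + (t + u * √(a : ℝ)) * √(b : ℝ) : ℝ) ∈ biquadraticField a b) :
    σ ⟨_, hx⟩ = r + s * σ ⟨_, sqrt_mem_biquadraticField_left a b⟩ +
      (t + u * σ ⟨_, sqrt_mem_biquadraticField_left a b⟩) *
        σ ⟨_, sqrt_mem_biquadraticField_right a b⟩ := by
  simp only [← map_ratCast σ, ← map_mul, ← map_add]
  exact congrArg σ (Subtype.ext (by simp))

lemma add_mul_sqrt_mem_quadraticField (d : ℕ) (r s : ℚ) :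
    r + s * √(d : ℝ) ∈ quadraticField d :=
  add_mem (SubfieldClass.ratCast_mem _ r)
    (mul_mem (SubfieldClass.ratCast_mem _ s) (sqrt_mem_quadraticField d))

/-- With the conjugations `σ`, `τ` fixing `√a`, `√b` respectively, `y² (σy · τy) = (y · σy)(y · τy)`
and the three products are relative norms to the quadratic subfields. -/
lemma IsUnitIn.exists_sq_mul_eq (ha : ¬IsSquare a) (hb : ¬IsSquare b) (hab : ¬IsSquare (a * b))
    (hy : IsUnitIn (biquadraticField a b) y) :
    ∃ u v w, IsUnitIn (quadraticField a) u ∧ IsUnitIn (quadraticField b) v ∧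
      IsUnitIn (quadraticField (a * b)) w ∧ y ^ 2 * w = u * v := by
  obtain ⟨σ, hσa, hσb⟩ := exists_conj_biquadraticField_right hb hab
  obtain ⟨τ, hτa, hτb⟩ := exists_conj_biquadraticField_left ha hab
  obtain ⟨r, s, t, u, rfl⟩ := exists_coords_of_mem_biquadraticField hy.mem
  have hσy := map_coords σ hy.mem
  have hτy := map_coords τ hy.mem
  rw [hσa, hσb] at hσy
  rw [hτa, hτb] at hτy
  have ha2 := sq_sqrt_natCast a
  have hb2 := sq_sqrt_natCast b
  have hu := hy.mul_of_mem (M := quadraticField a) (hy.map σ) (by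
    rw [hσy]
    convert sub_mem (pow_mem (add_mul_sqrt_mem_quadraticField a r s) 2)
      (mul_mem (_root_.natCast_mem _ b) (pow_mem (add_mul_sqrt_mem_quadraticField a t u) 2)) using 1
    linear_combination (-(t + u * √(a : ℝ)) ^ 2) * hb2)
  have hv := hy.mul_of_mem (M := quadraticField b) (hy.map τ) (by
    rw [hτy]
    convert sub_mem (pow_mem (add_mul_sqrt_mem_quadraticField b r t) 2)
      (mul_mem (_root_.natCast_mem _ a) (pow_mem (add_mul_sqrt_mem_quadraticField b s u) 2)) using 1
    linear_combination (-(s + u * √(b : ℝ)) ^ 2) * ha2)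
  have hw := (hy.map σ).mul_of_mem (M := quadraticField (a * b)) (hy.map τ) (by
    rw [hσy, hτy]
    convert add_mul_sqrt_mem_quadraticField (a * b)
      (r ^ 2 - a * s ^ 2 - b * t ^ 2 + a * b * u ^ 2) (2 * s * t - 2 * r * u) using 1
    rw [sqrt_natCast_mul]
    push_cast
    linear_combination (u ^ 2 * √(b : ℝ) ^ 2 - s ^ 2) * ha2 + (a * u ^ 2 - t ^ 2) * hb2)
  exact ⟨_, _, _, hu, hv, hw, by ring⟩

lemma isUnitIn_fundamentalUnit_of_sqrt_mem (hd : ¬IsSquare d) (hm : √(d : ℝ) ∈ K) :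
    IsUnitIn K (fundamentalUnit d) :=
  (isUnitIn_fundamentalUnit hd).of_mem (quadraticField_le hm (isUnitIn_fundamentalUnit hd).mem)

lemma IsUnitIn.exists_sq_eq_zpow (ha : ¬IsSquare a) (hb : ¬IsSquare b) (hab : ¬IsSquare (a * b))
    (hy : IsUnitIn (biquadraticField a b) y) :
    ∃ A B C : ℤ, y ^ 2 =
      fundamentalUnit a ^ A * fundamentalUnit b ^ B * fundamentalUnit (a * b) ^ C := by
  obtain ⟨u, v, w, hu, hv, hw, h⟩ := hy.exists_sq_mul_eq ha hb hab
  obtain ⟨A, hA⟩ := exists_abs_eq_fundamentalUnit_zpow ha hu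
  obtain ⟨B, hB⟩ := exists_abs_eq_fundamentalUnit_zpow hb hv
  obtain ⟨C, hC⟩ := exists_abs_eq_fundamentalUnit_zpow hab hw
  refine ⟨A, B, -C, ?_⟩
  rw [zpow_neg, ← hA, ← hB, ← hC, ← div_eq_mul_inv, ← abs_mul, ← h, abs_mul, abs_sq,
    mul_div_cancel_right₀ _ (abs_ne_zero.2 hw.ne_zero)]

lemma map_eq_self_of_mem_quadraticField {σ : K →ₐ[ℚ] ℝ} (hm : √(d : ℝ) ∈ K)
    (hσ : σ ⟨_, hm⟩ = √(d : ℝ)) (hx : x ∈ quadraticField d) (hxK : x ∈ K) : σ ⟨x, hxK⟩ = x := by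
  obtain ⟨r, s, rfl⟩ := exists_coords_of_mem_quadraticField hx
  rw [map_add_mul_sqrt σ hm, hσ]

lemma abs_map_fundamentalUnit (hd : ¬IsSquare d) {σ : K →ₐ[ℚ] ℝ} (hm : √(d : ℝ) ∈ K)
    (hσ : σ ⟨_, hm⟩ = -√(d : ℝ)) (hεK : fundamentalUnit d ∈ K) :
    |σ ⟨_, hεK⟩| = (fundamentalUnit d)⁻¹ := by
  have habs : |fundamentalUnit d * σ ⟨_, hεK⟩| = 1 := by
    rcases (isUnitIn_fundamentalUnit hd).hasNorm_one_or_neg_one hd with h | h <;>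
      simp [h.mul_map hm hσ]
  rw [abs_mul, abs_of_pos (fundamentalUnit_pos hd)] at habs
  exact eq_inv_of_mul_eq_one_right habs

lemma map_zpow_mul_zpow_mul_zpow (σ : K →ₐ[ℚ] ℝ) (h₁ : e₁ ∈ K) (h₂ : e₂ ∈ K) (h₃ : e₃ ∈ K)
    (hy : y ∈ K) {A B C : ℤ} (h : y = e₁ ^ A * e₂ ^ B * e₃ ^ C) :
    σ ⟨y, hy⟩ = σ ⟨e₁, h₁⟩ ^ A * σ ⟨e₂, h₂⟩ ^ B * σ ⟨e₃, h₃⟩ ^ C := by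
  simp only [← map_zpow₀, ← map_mul]
  exact congrArg σ (Subtype.ext h)

lemma eq_zero_of_fundamentalUnit_zpow_mul_eq_one (ha : ¬IsSquare a) (hb : ¬IsSquare b)
    (hab : ¬IsSquare (a * b)) {A B C : ℤ}
    (h : fundamentalUnit a ^ A * fundamentalUnit b ^ B * fundamentalUnit (a * b) ^ C = 1) :
    A = 0 := by
  obtain ⟨σ, hσa, hσb⟩ := exists_conj_biquadraticField_right hb hab
  have hσab : σ ⟨_, sqrt_mul_mem_biquadraticField a b⟩ = -√((a * b : ℕ) : ℝ) := by
    rw [map_sqrt_mul, hσa, hσb, mul_neg, sqrt_natCast_mul]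
  have ua := isUnitIn_fundamentalUnit_of_sqrt_mem ha (sqrt_mem_biquadraticField_left a b)
  have ub := isUnitIn_fundamentalUnit_of_sqrt_mem hb (sqrt_mem_biquadraticField_right a b)
  have uab := isUnitIn_fundamentalUnit_of_sqrt_mem hab (sqrt_mul_mem_biquadraticField a b)
  have hconj : 1 = fundamentalUnit a ^ A * (fundamentalUnit b)⁻¹ ^ B *
      (fundamentalUnit (a * b))⁻¹ ^ C := by
    have hmap := map_zpow_mul_zpow_mul_zpow σ ua.mem ub.mem uab.mem (one_mem _) h.symm
    rw [← abs_map_fundamentalUnit hb _ hσb ub.mem, ← abs_map_fundamentalUnit hab _ hσab uab.mem,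
      ← abs_of_pos (fundamentalUnit_pos ha)]
    rw [map_eq_self_of_mem_quadraticField _ hσa (isUnitIn_fundamentalUnit ha).mem] at hmap
    rw [← abs_zpow, ← abs_zpow, ← abs_zpow, ← abs_mul, ← abs_mul, ← hmap]
    exact (abs_one.symm.trans (congrArg _ (map_one σ).symm))
  have hsq : fundamentalUnit a ^ (A + A) = 1 := by
    have hb0 := zpow_ne_zero B (fundamentalUnit_pos hb).ne'
    have hab0 := zpow_ne_zero C (fundamentalUnit_pos hab).ne'
    rw [inv_zpow, inv_zpow] at hconj
    calc fundamentalUnit a ^ (A + A)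
        = (fundamentalUnit a ^ A * fundamentalUnit b ^ B * fundamentalUnit (a * b) ^ C) *
          (fundamentalUnit a ^ A * (fundamentalUnit b ^ B)⁻¹ *
            (fundamentalUnit (a * b) ^ C)⁻¹) := by
          rw [zpow_add₀ (fundamentalUnit_pos ha).ne']; field_simp
      _ = 1 := by rw [h, ← hconj, one_mul]
  rw [zpow_eq_one_iff_right₀ (fundamentalUnit_pos ha).le (one_lt_fundamentalUnit ha).ne'] at hsq
  omega

lemma even_exponent_of_sq_eq (ha : ¬IsSquare a) (hb : ¬IsSquare b)
    (hab : ¬IsSquare (a * b)) (hna : HasNorm a (fundamentalUnit a) (-1))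
    (hnab : HasNorm (a * b) (fundamentalUnit (a * b)) 1) (hy : y ∈ biquadraticField a b)
    (hy0 : y ≠ 0) {A B C : ℤ}
    (h : y ^ 2 = fundamentalUnit a ^ A * fundamentalUnit b ^ B * fundamentalUnit (a * b) ^ C) :
    Even A := by
  obtain ⟨τ, hτa, hτb⟩ := exists_conj_biquadraticField_left ha hab
  have hτab : τ ⟨_, sqrt_mul_mem_biquadraticField a b⟩ = -√((a * b : ℕ) : ℝ) := by
    rw [map_sqrt_mul, hτa, hτb, neg_mul, sqrt_natCast_mul]
  have ua := isUnitIn_fundamentalUnit_of_sqrt_mem ha (sqrt_mem_biquadraticField_left a b)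
  have ub := isUnitIn_fundamentalUnit_of_sqrt_mem hb (sqrt_mem_biquadraticField_right a b)
  have uab := isUnitIn_fundamentalUnit_of_sqrt_mem hab (sqrt_mul_mem_biquadraticField a b)
  have hτεa : τ ⟨_, ua.mem⟩ < 0 := by
    have := hna.mul_map _ hτa ua.mem
    exact (pos_iff_neg_of_mul_neg (by rw [this]; simp)).1 (fundamentalUnit_pos ha)
  have hτεab : 0 < τ ⟨_, uab.mem⟩ := by
    have := hnab.mul_map _ hτab uab.mem
    exact (pos_iff_pos_of_mul_pos (by rw [this]; simp)).1 (fundamentalUnit_pos hab)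
  have hτy : 0 < τ ⟨_, hy⟩ ^ 2 := sq_pos_of_ne_zero <|
    (map_ne_zero τ).2 fun h0 => hy0 (congrArg Subtype.val h0)
  have hmap := map_zpow_mul_zpow_mul_zpow τ ua.mem ub.mem uab.mem (pow_mem hy 2) h
  rw [map_eq_self_of_mem_quadraticField _ hτb (isUnitIn_fundamentalUnit hb).mem] at hmap
  have hpos : 0 < τ ⟨_, ua.mem⟩ ^ A := by
    refine pos_of_mul_pos_left (b := fundamentalUnit b ^ B * τ ⟨_, uab.mem⟩ ^ C) ?_
      (mul_pos (zpow_pos (fundamentalUnit_pos hb) _) (zpow_pos hτεab _)).le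
    rw [← mul_assoc, ← hmap]
    exact hτy.trans_eq (map_pow τ _ 2).symm
  by_contra hodd
  exact hpos.not_gt ((Int.not_even_iff_odd.1 hodd).zpow_neg hτεa)

end BiquadraticUnits

section UnitSquares

variable {K : IntermediateField ℚ ℝ} {a b : ℕ} {x y e e₁ e₂ e₃ : ℝ}

/-- The positive units `e₁, e₂, e₃` of `K` are multiplicatively independent, and the square of
every unit of `K` is a product of powers of them in which the exponent of `e₁` is even. A
fundamental system of units of `K` is then read off from the square roots that `K` contains. -/
structure SpansUnitSquares (K : IntermediateField ℚ ℝ) (e₁ e₂ e₃ : ℝ) : Prop where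
  isUnitIn₁ : IsUnitIn K e₁
  isUnitIn₂ : IsUnitIn K e₂
  isUnitIn₃ : IsUnitIn K e₃
  pos₁ : 0 < e₁
  pos₂ : 0 < e₂
  pos₃ : 0 < e₃
  independent : ∀ {A B C : ℤ}, e₁ ^ A * e₂ ^ B * e₃ ^ C = 1 → A = 0 ∧ B = 0 ∧ C = 0
  exists_sq_eq : ∀ {y : ℝ}, IsUnitIn K y → ∃ A B C : ℤ, y ^ 2 = (e₁ ^ A) ^ 2 * e₂ ^ B * e₃ ^ C

theorem spansUnitSquares_fundamentalUnit (ha : ¬IsSquare a) (hb : ¬IsSquare b)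
    (hab : ¬IsSquare (a * b)) (hna : HasNorm a (fundamentalUnit a) (-1))
    (hnab : HasNorm (a * b) (fundamentalUnit (a * b)) 1) :
    SpansUnitSquares (biquadraticField a b)
      (fundamentalUnit a) (fundamentalUnit b) (fundamentalUnit (a * b)) where
  isUnitIn₁ := isUnitIn_fundamentalUnit_of_sqrt_mem ha (sqrt_mem_biquadraticField_left a b)
  isUnitIn₂ := isUnitIn_fundamentalUnit_of_sqrt_mem hb (sqrt_mem_biquadraticField_right a b)
  isUnitIn₃ := isUnitIn_fundamentalUnit_of_sqrt_mem hab (sqrt_mul_mem_biquadraticField a b)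
  pos₁ := fundamentalUnit_pos ha
  pos₂ := fundamentalUnit_pos hb
  pos₃ := fundamentalUnit_pos hab
  independent {A B C} h := by
    obtain rfl : A = 0 := eq_zero_of_fundamentalUnit_zpow_mul_eq_one ha hb hab h
    obtain rfl : B = 0 := by
      rw [mul_comm a b] at h hab
      exact eq_zero_of_fundamentalUnit_zpow_mul_eq_one (B := 0) hb ha hab
        (by rwa [mul_comm (_ ^ B)])
    rw [zpow_zero, zpow_zero, one_mul, one_mul] at h
    exact ⟨rfl, rfl, (zpow_eq_one_iff_right₀ (fundamentalUnit_pos hab).le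
      (one_lt_fundamentalUnit hab).ne').1 h⟩
  exists_sq_eq {y} hy := by
    obtain ⟨A, B, C, h⟩ := hy.exists_sq_eq_zpow ha hb hab
    obtain ⟨m, rfl⟩ := even_exponent_of_sq_eq ha hb hab hna hnab hy.mem hy.ne_zero h
    exact ⟨m, B, C, by rw [h, zpow_add₀ (fundamentalUnit_pos ha).ne', sq]⟩

lemma sqrt_zpow_sq (he : 0 ≤ e) (n : ℤ) : (√e ^ n) ^ 2 = e ^ n := by
  rw [← zpow_natCast, zpow_comm, zpow_natCast, Real.sq_sqrt he]

lemma zpow_sq (e : ℝ) (n : ℤ) : (e ^ n) ^ 2 = e ^ (n * 2) :=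
  (zpow_natCast _ 2).symm.trans (zpow_mul e n 2).symm

lemma IsUnitIn.sqrt (h : IsUnitIn K e) (he : 0 ≤ e) (hm : √e ∈ K) : IsUnitIn K √e :=
  .of_sq hm (by rwa [Real.sq_sqrt he])

namespace SpansUnitSquares

lemma mul_right (h : SpansUnitSquares K e₁ e₂ e₃) : SpansUnitSquares K e₁ e₂ (e₂ * e₃) where
  isUnitIn₁ := h.isUnitIn₁
  isUnitIn₂ := h.isUnitIn₂
  isUnitIn₃ := h.isUnitIn₂.mul h.isUnitIn₃
  pos₁ := h.pos₁
  pos₂ := h.pos₂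
  pos₃ := mul_pos h.pos₂ h.pos₃
  independent {A B C} hABC := by
    have hprod : e₁ ^ A * e₂ ^ (B + C) * e₃ ^ C = 1 := by
      rw [← hABC, zpow_add₀ h.pos₂.ne', mul_zpow]
      ring
    obtain ⟨hA, hBC, hC⟩ := h.independent hprod
    omega
  exists_sq_eq hy := by
    obtain ⟨A, B, C, hABC⟩ := h.exists_sq_eq hy
    refine ⟨A, B - C, C, ?_⟩
    have hC := zpow_ne_zero C h.pos₂.ne'
    rw [hABC, zpow_sub₀ h.pos₂.ne', mul_zpow]
    field_simp

lemma exists_eq_zpow_of_sq_eq (h : SpansUnitSquares K e₁ e₂ e₃) (h₂ : √e₂ ∉ K)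
    (hx : x ∈ K) (hx0 : 0 < x) (hy : y ∈ K) (hy0 : 0 < y) {A B : ℤ}
    (hsq : y ^ 2 = (e₁ ^ A) ^ 2 * e₂ ^ B * x ^ 2) : ∃ m : ℤ, y = e₁ ^ A * e₂ ^ m * x := by
  have p₁ : 0 < e₁ ^ A := zpow_pos h.pos₁ _
  obtain ⟨m, rfl | rfl⟩ := B.even_or_odd'
  · refine ⟨m, (sq_eq_sq₀ hy0.le ?_).1 ?_⟩
    · exact (mul_pos (mul_pos p₁ (zpow_pos h.pos₂ _)) hx0).le
    · rw [hsq, mul_pow, mul_pow, zpow_sq e₂, mul_comm m]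
  · refine absurd ?_ h₂
    have hz : 0 < e₁ ^ A * e₂ ^ m * x := mul_pos (mul_pos p₁ (zpow_pos h.pos₂ _)) hx0
    have hsqrt : √e₂ = y / (e₁ ^ A * e₂ ^ m * x) := by
      refine (Real.sqrt_eq_iff_eq_sq h.pos₂.le (by positivity)).2 ?_
      rw [div_pow, eq_div_iff (by positivity), hsq, zpow_add_one₀ h.pos₂.ne', mul_comm 2,
        ← zpow_sq]
      ring
    rw [hsqrt]
    exact div_mem hy (mul_mem (mul_mem (zpow_mem h.isUnitIn₁.mem _)
      (zpow_mem h.isUnitIn₂.mem _)) hx)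

theorem isFSU_sqrt_right (h : SpansUnitSquares K e₁ e₂ e₃) (h₂ : √e₂ ∉ K) (h₃ : √e₃ ∈ K) :
    IsFSU K ![e₁, e₂, √e₃] := by
  have p₃ := Real.sqrt_pos.2 h.pos₃
  refine isFSU_three h.isUnitIn₁ h.isUnitIn₂ (h.isUnitIn₃.sqrt h.pos₃.le h₃) h.pos₁ h.pos₂ p₃
    (fun y hy hy0 => ?_) (fun A B C hABC => ?_)
  · obtain ⟨A, B, C, hABC⟩ := h.exists_sq_eq hy
    rw [← sqrt_zpow_sq h.pos₃.le] at hABC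
    obtain ⟨m, hm⟩ := h.exists_eq_zpow_of_sq_eq h₂ (zpow_mem h₃ C) (zpow_pos p₃ C) hy.mem hy0 hABC
    exact ⟨A, m, C, hm⟩
  · have hsq := congrArg (· ^ 2) hABC
    simp only [mul_pow, sqrt_zpow_sq h.pos₃.le, zpow_sq e₁, zpow_sq e₂, one_pow] at hsq
    obtain ⟨hA, hB, hC⟩ := h.independent hsq
    omega

theorem isFSU_sqrt_sqrt (h : SpansUnitSquares K e₁ e₂ e₃) (h₂ : √e₂ ∈ K) (h₃ : √e₃ ∈ K) :
    IsFSU K ![e₁, √e₂, √e₃] := by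
  have p₂ := Real.sqrt_pos.2 h.pos₂
  have p₃ := Real.sqrt_pos.2 h.pos₃
  refine isFSU_three h.isUnitIn₁ (h.isUnitIn₂.sqrt h.pos₂.le h₂) (h.isUnitIn₃.sqrt h.pos₃.le h₃)
    h.pos₁ p₂ p₃ (fun y hy hy0 => ?_) (fun A B C hABC => ?_)
  · obtain ⟨A, B, C, hABC⟩ := h.exists_sq_eq hy
    refine ⟨A, B, C, (sq_eq_sq₀ hy0.le ?_).1 ?_⟩
    · exact (mul_pos (mul_pos (zpow_pos h.pos₁ A) (zpow_pos p₂ B)) (zpow_pos p₃ C)).le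
    · rw [hABC, mul_pow, mul_pow, sqrt_zpow_sq h.pos₂.le, sqrt_zpow_sq h.pos₃.le]
  · have hsq := congrArg (· ^ 2) hABC
    simp only [mul_pow, sqrt_zpow_sq h.pos₂.le, sqrt_zpow_sq h.pos₃.le, zpow_sq e₁, one_pow]
      at hsq
    obtain ⟨hA, hB, hC⟩ := h.independent hsq
    omega

end SpansUnitSquares

end UnitSquares

section NormOneUnits

variable {K : IntermediateField ℚ ℝ} {b c c' d m n p q s δ V W : ℕ} {x : ℝ}

lemma exists_intCast_eq_of_mul_sq_eq_intCast (hd : Squarefree d) {s : ℚ} {N : ℤ}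
    (h : d * s ^ 2 = N) : ∃ m : ℤ, s = m := by
  have hnum : (d : ℤ) * s.num ^ 2 = N * (s.den : ℤ) ^ 2 := by
    have hden : (s.den : ℚ) ≠ 0 := mod_cast s.den_nz
    have : (d : ℚ) * s.num ^ 2 = N * (s.den : ℚ) ^ 2 := by
      rw [← h]
      nth_rw 2 [← Rat.num_div_den s]
      field_simp
    exact_mod_cast this
  have hdvd : (s.den : ℤ) ^ 2 ∣ d :=
    (Rat.isCoprime_num_den s).symm.pow.dvd_of_dvd_mul_right (Dvd.intro_left N hnum.symm)
  have hden : s.den = 1 := Nat.isUnit_iff.1 (hd _ (by rw [← sq]; exact_mod_cast hdvd))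
  exact ⟨s.num, ((Rat.den_eq_one_iff s).1 hden).symm⟩

lemma IsUnitIn.exists_trace_sq_sub_eq (hd : Squarefree d) (hx : IsUnitIn K x) {n : ℤ}
    (h : HasNorm d x n) : ∃ t s : ℤ, x + n * x⁻¹ = t ∧ t ^ 2 - 4 * n = d * s ^ 2 := by
  obtain ⟨t, ht⟩ := hx.exists_intCast_eq_trace h
  obtain ⟨r, s, hrs, hn⟩ := h
  have htr : (t : ℚ) = 2 * r := by
    have : (t : ℝ) = 2 * r := by rw [← ht, mul_inv_eq_sub_mul_sqrt hx.ne_zero hrs hn, hrs]; ring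
    exact_mod_cast this
  obtain ⟨m, hm⟩ := exists_intCast_eq_of_mul_sq_eq_intCast hd (s := 2 * s) (N := t ^ 2 - 4 * n)
    (by push_cast; rw [htr, ← hn]; ring)
  refine ⟨t, m, ht, ?_⟩
  have : (t : ℚ) ^ 2 - 4 * n = d * (m : ℚ) ^ 2 := by rw [← hm, htr, ← hn]; ring
  exact_mod_cast this

lemma IsUnitIn.hasNorm_one_of_prime_dvd [Fact q.Prime] (hq : q % 4 = 3) (hqd : q ∣ d)
    (hd : Squarefree d) (hd' : ¬IsSquare d) (hx : IsUnitIn (quadraticField d) x) :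
    HasNorm d x 1 := by
  refine (hx.hasNorm_one_or_neg_one hd').resolve_right fun h => ?_
  obtain ⟨t, s, -, hts⟩ := hx.exists_trace_sq_sub_eq hd h
  have two_ne : (2 : ZMod q) ≠ 0 := by
    rw [← Nat.cast_ofNat, Ne, ZMod.natCast_eq_zero_iff,
      Nat.prime_dvd_prime_iff_eq Fact.out Nat.prime_two]
    omega
  have hsq : (t : ZMod q) ^ 2 = -2 ^ 2 := by
    have hmod := congrArg (Int.cast (R := ZMod q)) hts
    push_cast at hmod
    rw [(ZMod.natCast_eq_zero_iff d q).2 hqd] at hmod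
    linear_combination hmod
  exact ZMod.mod_four_ne_three_of_sq_eq_neg_sq' two_ne hsq hq

lemma IsUnitIn.exists_add_inv_eq (hd : Squarefree d) (hx : IsUnitIn K x) (hx0 : 0 < x)
    (h : HasNorm d x 1) : ∃ n s : ℕ, (n + 4) * n = d * s ^ 2 ∧ x + x⁻¹ = n + 2 := by
  obtain ⟨t, s, ht, hts⟩ := hx.exists_trace_sq_sub_eq hd h
  rw [Int.cast_one, one_mul] at ht
  have ht2 : 2 ≤ t := by
    have hnonneg : 0 ≤ (x - 1) ^ 2 * x⁻¹ := by positivity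
    have : (2 : ℝ) ≤ t := by
      rw [← ht]
      linear_combination hnonneg + (x - 2) * (mul_inv_cancel₀ hx.ne_zero)
    exact_mod_cast this
  obtain ⟨n, hn⟩ := Int.eq_ofNat_of_zero_le (a := t - 2) (by omega)
  obtain rfl : t = n + 2 := by omega
  refine ⟨n, s.natAbs, ?_, by rw [ht]; push_cast; rfl⟩
  zify
  rw [sq_abs, ← hts]
  ring

lemma sqrt_mul_sqrt_eq_sub_one (hx1 : 1 ≤ x) (h : x + x⁻¹ = n + 2) :
    √(n : ℝ) * √x = x - 1 := by
  have hx0 : x ≠ 0 := by positivity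
  rw [← Real.sqrt_mul n.cast_nonneg, Real.sqrt_eq_iff_eq_sq _ (sub_nonneg.2 hx1)]
  · linear_combination mul_inv_cancel₀ hx0 - x * h
  · positivity

lemma sqrt_add_four_mul_sqrt_eq_add_one (hx0 : 0 < x) (h : x + x⁻¹ = n + 2) :
    √((n + 4 : ℕ) : ℝ) * √x = x + 1 := by
  rw [← Real.sqrt_mul (Nat.cast_nonneg _), Real.sqrt_eq_iff_eq_sq (by positivity) (by positivity)]
  push_cast
  linear_combination mul_inv_cancel₀ hx0.ne' - x * h

lemma sqrt_mul_mem_of_isSquare_mul (h : IsSquare (c * c' * d)) (hc : c ≠ 0) (hd : d ≠ 0)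
    (hdK : √(d : ℝ) ∈ K) (hx : √(c : ℝ) * x ∈ K) : √(c' : ℝ) * x ∈ K := by
  obtain ⟨k, hk⟩ := h
  have hroot : √(c : ℝ) * √(c' : ℝ) * √(d : ℝ) = k := by
    rw [← sqrt_natCast_mul, ← sqrt_natCast_mul, hk, Nat.cast_mul,
      Real.sqrt_mul_self k.cast_nonneg]
  have hcd : (c : ℝ) * √(d : ℝ) ≠ 0 := by positivity
  have hquot : √(c' : ℝ) * x = k * (√(c : ℝ) * x) / (c * √(d : ℝ)) := by
    rw [eq_div_iff hcd, ← hroot]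
    linear_combination (-(√(c' : ℝ) * x * √(d : ℝ))) * sq_sqrt_natCast c
  rw [hquot]
  exact div_mem (mul_mem (natCast_mem K k) hx) (mul_mem (natCast_mem K c) hdK)

lemma dvd_mul_of_sq_mul_mul_eq (hδ : Squarefree δ) (hb : b ≠ 0)
    (h : b ^ 2 * δ * V = d * s ^ 2) : δ ∣ d * V := by
  obtain ⟨k, hk⟩ : IsSquare (δ * (d * V)) := by
    refine isSquare_of_isSquare_sq_mul hb ⟨d * s, ?_⟩
    linear_combination d * h
  have hδk : δ ∣ k := (hδ.dvd_pow_iff_dvd two_ne_zero).1 (by rw [sq, ← hk]; exact dvd_mul_right _ _)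
  exact Nat.dvd_of_mul_dvd_mul_left (Nat.pos_of_ne_zero hδ.ne_zero) (hk ▸ mul_dvd_mul hδk hδk)

lemma exists_sq_mul_squarefree_dvd (hW : W ≠ 0) (h : W * V = d * s ^ 2) (hgcd : W.gcd V ∣ 4)
    (hdm : d ∣ 2 * m) : ∃ b δ, b ≠ 0 ∧ b ^ 2 * δ = W ∧ δ ∣ 2 * m := by
  obtain ⟨δ, b, rfl, hδ⟩ := Nat.sq_mul_squarefree W
  have hb : b ≠ 0 := by rintro rfl; simp at hW
  refine ⟨b, δ, hb, rfl, (hδ.dvd_pow_iff_dvd three_ne_zero).1 ?_⟩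
  calc δ ∣ d * (b ^ 2 * δ).gcd V := by
        rw [← Nat.gcd_mul_left]
        exact Nat.dvd_gcd (dvd_mul_of_dvd_right (dvd_mul_left _ _) _)
          (dvd_mul_of_sq_mul_mul_eq hδ hb h)
    _ ∣ 2 * m * 4 := mul_dvd_mul hdm hgcd
    _ ∣ (2 * m) ^ 3 := ⟨m ^ 2, by ring⟩

lemma sqrt_mul_mem_of_sq_mul (hb : b ≠ 0) (h : √((b ^ 2 * δ : ℕ) : ℝ) * x ∈ K) :
    √(δ : ℝ) * x ∈ K := by
  have hb' : (b : ℝ) ≠ 0 := Nat.cast_ne_zero.2 hb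
  rw [sqrt_natCast_mul, Nat.cast_pow, Real.sqrt_sq b.cast_nonneg, mul_assoc] at h
  simpa [hb'] using div_mem h (natCast_mem K b)

lemma gcd_add_four_dvd (n : ℕ) : (n + 4).gcd n ∣ 4 :=
  (Nat.dvd_add_right (Nat.gcd_dvd_right _ _)).1 (Nat.gcd_dvd_left _ _)

lemma IsUnitIn.exists_dvd_two_mul_sqrt_mul_sqrt_mem (hd : Squarefree d)
    (hx : IsUnitIn (quadraticField d) x) (hx0 : 0 < x) (h : HasNorm d x 1) (hdm : d ∣ 2 * m) :
    ∃ δ, δ ∣ 2 * m ∧ √(δ : ℝ) * √x ∈ quadraticField d := by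
  obtain ⟨n, s, hns, htr⟩ := hx.exists_add_inv_eq hd hx0 h
  obtain ⟨b, δ, hb, hW, hδ⟩ :=
    exists_sq_mul_squarefree_dvd (by omega) hns (gcd_add_four_dvd n) hdm
  refine ⟨δ, hδ, sqrt_mul_mem_of_sq_mul hb ?_⟩
  rw [hW, sqrt_add_four_mul_sqrt_eq_add_one hx0 htr]
  exact add_mem hx.mem (one_mem _)

lemma isSquare_and_not_dvd_of_dvd_mul_add_four [Fact p.Prime] (hp : p % 4 = 1)
    (h : p ∣ (n + 4) * n) :
    (IsSquare ((n + 4 : ℕ) : ZMod p) ∧ ¬p ∣ n + 4) ∨ (IsSquare (n : ZMod p) ∧ ¬p ∣ n) := by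
  have hp' : p.Prime := Fact.out
  have hp4 : ¬p ∣ 4 := fun h4 => by
    have := (Nat.prime_dvd_prime_iff_eq hp' Nat.prime_two).1 (hp'.dvd_of_dvd_pow (n := 2) h4)
    omega
  have hfour : IsSquare (4 : ZMod p) := ⟨2, by norm_num⟩
  rcases hp'.dvd_mul.1 h with h | h
  · refine .inr ⟨?_, fun h' => hp4 ((Nat.dvd_add_right h').1 h)⟩
    have hneg : (n : ZMod p) = -1 * 4 := by
      have := (ZMod.natCast_eq_zero_iff _ _).2 h
      push_cast at this
      linear_combination this
    exact hneg ▸ (ZMod.exists_sq_eq_neg_one_iff.2 (by omega)).mul hfour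
  · refine .inl ⟨?_, fun h' => hp4 ((Nat.dvd_add_right h).1 h')⟩
    rwa [Nat.cast_add, (ZMod.natCast_eq_zero_iff _ _).2 h, zero_add, Nat.cast_ofNat]

/-- As `p ≡ 5 [MOD 8]`, `2` is not a square modulo `p`. -/
lemma dvd_of_dvd_two_mul_of_isSquare [Fact p.Prime] (hp : p % 8 = 5)
    (hm : ∀ y, y ∣ m → IsSquare (y : ZMod p)) (hδ : δ ∣ 2 * m) (hpδ : ¬p ∣ δ)
    (hsq : IsSquare (δ : ZMod p)) : δ ∣ m := by
  obtain ⟨x, y, hx, hy, rfl⟩ := Nat.dvd_mul.1 hδ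
  rcases (Nat.dvd_prime Nat.prime_two).1 hx with rfl | rfl
  · rwa [one_mul]
  · have hy0 : (y : ZMod p) ≠ 0 := fun h =>
      hpδ (dvd_mul_of_dvd_right ((ZMod.natCast_eq_zero_iff y p).1 h) 2)
    have htwo : IsSquare (2 : ZMod p) := by
      simpa [hy0] using hsq.div (hm y hy)
    have := (ZMod.exists_sq_eq_two_iff (by omega)).1 htwo
    omega

lemma exists_dvd_sqrt_mul_mem_of_factor [Fact p.Prime] (hp : p % 8 = 5)
    (hm : ∀ y, y ∣ m → IsSquare (y : ZMod p)) (hdm : d ∣ 2 * (p * m)) (hWV : W * V = d * s ^ 2)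
    (hgcd : W.gcd V ∣ 4) (hsq : IsSquare (W : ZMod p)) (hpW : ¬p ∣ W)
    (hx : √(W : ℝ) * x ∈ K) : ∃ δ, δ ∣ m ∧ √(δ : ℝ) * x ∈ K := by
  have hW : W ≠ 0 := by rintro rfl; simp at hpW
  obtain ⟨b, δ, hb, rfl, hδ⟩ := exists_sq_mul_squarefree_dvd hW hWV hgcd hdm
  have hpδ : ¬p ∣ δ := fun h => hpW (dvd_mul_of_dvd_right h _)
  have hb0 : (b : ZMod p) ≠ 0 := fun h =>
    hpW (((ZMod.natCast_eq_zero_iff b p).1 h).mul_right _ |>.trans (by rw [sq, mul_assoc]))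
  have hδsq : IsSquare (δ : ZMod p) := by
    simpa [hb0] using hsq.div (IsSquare.sq (b : ZMod p))
  refine ⟨δ, dvd_of_dvd_two_mul_of_isSquare hp hm ?_ hpδ hδsq, sqrt_mul_mem_of_sq_mul hb hx⟩
  have hcop : δ.Coprime p := ((Nat.Prime.coprime_iff_not_dvd Fact.out).2 hpδ).symm
  exact hcop.dvd_of_dvd_mul_left (by rwa [mul_left_comm] at hδ)

lemma IsUnitIn.exists_dvd_sqrt_mul_sqrt_mem [Fact p.Prime] (hp : p % 8 = 5)
    (hm : ∀ y, y ∣ m → IsSquare (y : ZMod p)) (hpd : p ∣ d) (hdm : d ∣ 2 * (p * m))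
    (hd : Squarefree d) (hx : IsUnitIn (quadraticField d) x) (hx1 : 1 ≤ x) (h : HasNorm d x 1) :
    ∃ δ, δ ∣ m ∧ √(δ : ℝ) * √x ∈ quadraticField d := by
  obtain ⟨n, s, hns, htr⟩ := hx.exists_add_inv_eq hd (by positivity) h
  rcases isSquare_and_not_dvd_of_dvd_mul_add_four (by omega) (hns ▸ hpd.mul_right _) with
    ⟨hsq, hpn⟩ | ⟨hsq, hpn⟩
  · refine exists_dvd_sqrt_mul_mem_of_factor hp hm hdm hns (gcd_add_four_dvd n) hsq hpn ?_
    rw [sqrt_add_four_mul_sqrt_eq_add_one (by positivity) htr]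
    exact add_mem hx.mem (one_mem _)
  · refine exists_dvd_sqrt_mul_mem_of_factor hp hm hdm (mul_comm n _ ▸ hns)
      (Nat.gcd_comm n _ ▸ gcd_add_four_dvd n) hsq hpn ?_
    rw [sqrt_mul_sqrt_eq_sub_one hx1 htr]
    exact sub_mem hx.mem (one_mem _)

end NormOneUnits

section FundamentalUnits

variable {d p q δ : ℕ}

lemma sqrt_mul_sqrt_fundamentalUnit_notMem (hd : ¬IsSquare d) (hδ : δ ≠ 0)
    (h : IsSquare δ ∨ IsSquare (δ * d)) : √(δ : ℝ) * √(fundamentalUnit d) ∉ quadraticField d := by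
  intro hm
  have hd0 : d ≠ 0 := by rintro rfl; exact hd ⟨0, rfl⟩
  refine sqrt_fundamentalUnit_notMem hd ?_
  rw [← one_mul √(fundamentalUnit d), ← Real.sqrt_one, ← Nat.cast_one]
  rcases h with h | h
  · exact sqrt_mul_mem_of_isSquare_mul (d := 1) (by simpa using h) hδ one_ne_zero (by simp) hm
  · exact sqrt_mul_mem_of_isSquare_mul (by simpa using h) hδ hd0 (sqrt_mem_quadraticField d) hm

lemma hasNorm_fundamentalUnit_two : HasNorm 2 (fundamentalUnit 2) (-1) := by
  have h2 : ¬IsSquare 2 := Nat.prime_two.prime.not_isSquare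
  refine ((isUnitIn_fundamentalUnit h2).hasNorm_one_or_neg_one h2).resolve_left fun h => ?_
  obtain ⟨δ, hδ, hm⟩ := (isUnitIn_fundamentalUnit h2).exists_dvd_two_mul_sqrt_mul_sqrt_mem
    Nat.prime_two.squarefree (fundamentalUnit_pos h2) h (m := 1) (by simp)
  rcases (Nat.dvd_prime Nat.prime_two).1 hδ with rfl | rfl
  · exact sqrt_mul_sqrt_fundamentalUnit_notMem h2 one_ne_zero (.inl ⟨1, rfl⟩) hm
  · exact sqrt_mul_sqrt_fundamentalUnit_notMem h2 two_ne_zero (.inr ⟨2, rfl⟩) hm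

lemma not_isSquare_of_prime_dvd (hq : q.Prime) (hqd : q ∣ d) (hd : Squarefree d) : ¬IsSquare d :=
  not_isSquare_of_squarefree hd (by rintro rfl; exact hq.not_dvd_one hqd)

lemma hasNorm_fundamentalUnit_neg_one [Fact p.Prime] (hp : p % 8 = 5) (hpd : p ∣ d)
    (hdp : d ∣ 2 * p) (hd : Squarefree d) : HasNorm d (fundamentalUnit d) (-1) := by
  have hd' := not_isSquare_of_prime_dvd Fact.out hpd hd
  refine ((isUnitIn_fundamentalUnit hd').hasNorm_one_or_neg_one hd').resolve_left fun h => ?_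
  obtain ⟨δ, hδ, hm⟩ := (isUnitIn_fundamentalUnit hd').exists_dvd_sqrt_mul_sqrt_mem (m := 1) hp
    (fun y hy => by rw [Nat.dvd_one.1 hy]; exact ⟨1, by simp⟩) hpd (by rwa [mul_one]) hd
    (one_lt_fundamentalUnit hd').le h
  obtain rfl := Nat.dvd_one.1 hδ
  exact sqrt_mul_sqrt_fundamentalUnit_notMem hd' one_ne_zero (.inl ⟨1, rfl⟩) hm

lemma hasNorm_fundamentalUnit_one [Fact q.Prime] (hq : q % 4 = 3) (hqd : q ∣ d)
    (hd : Squarefree d) : HasNorm d (fundamentalUnit d) 1 :=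
  have hd' := not_isSquare_of_prime_dvd Fact.out hqd hd
  (isUnitIn_fundamentalUnit hd').hasNorm_one_of_prime_dvd hq hqd hd hd'

lemma sqrt_two_mul_sqrt_fundamentalUnit_mem (hq : q.Prime) (hdq : d = q ∨ d = 2 * q)
    (hd : Squarefree d) (h : HasNorm d (fundamentalUnit d) 1) :
    √((2 : ℕ) : ℝ) * √(fundamentalUnit d) ∈ quadraticField d := by
  have hqd : q ∣ d := by rcases hdq with rfl | rfl <;> simp
  have hd2 : d ∣ 2 * q := by rcases hdq with rfl | rfl <;> simp
  have hd' := not_isSquare_of_prime_dvd hq hqd hd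
  obtain ⟨δ, hδ, hm⟩ := (isUnitIn_fundamentalUnit hd').exists_dvd_two_mul_sqrt_mul_sqrt_mem hd
    (fundamentalUnit_pos hd') h hd2
  have hδ0 : δ ≠ 0 := ne_zero_of_dvd_ne_zero (mul_ne_zero two_ne_zero hq.ne_zero) hδ
  obtain ⟨y, z, hy, hz, rfl⟩ := Nat.dvd_mul.1 hδ
  have exclude (hsq : IsSquare (y * z) ∨ IsSquare (y * z * d)) :
      √((2 : ℕ) : ℝ) * √(fundamentalUnit d) ∈ quadraticField d :=
    absurd hm (sqrt_mul_sqrt_fundamentalUnit_notMem hd' hδ0 hsq)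
  have change (hsq : IsSquare (y * z * 2 * d)) :
      √((2 : ℕ) : ℝ) * √(fundamentalUnit d) ∈ quadraticField d :=
    sqrt_mul_mem_of_isSquare_mul hsq hδ0 hd.ne_zero (sqrt_mem_quadraticField d) hm
  rcases (Nat.dvd_prime Nat.prime_two).1 hy with rfl | rfl <;>
    rcases (Nat.dvd_prime hq).1 hz with rfl | rfl
  · exact exclude (.inl ⟨1, rfl⟩)
  · rcases hdq with rfl | rfl
    · exact exclude (.inr ⟨d, by ring⟩)
    · exact change ⟨2 * z, by ring⟩
  · exact hm
  · rcases hdq with rfl | rfl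
    · exact change ⟨2 * d, by ring⟩
    · exact exclude (.inr ⟨2 * z, by ring⟩)

lemma sqrt_prime_mul_sqrt_fundamentalUnit_mem [Fact p.Prime] (hp : p % 8 = 5) (hq : q.Prime)
    (hqp : IsSquare (q : ZMod p)) (hpd : p ∣ d) (hdpq : d ∣ 2 * (p * q)) (hd : Squarefree d)
    (h : HasNorm d (fundamentalUnit d) 1) :
    √(q : ℝ) * √(fundamentalUnit d) ∈ quadraticField d := by
  have hd' := not_isSquare_of_prime_dvd Fact.out hpd hd
  obtain ⟨δ, hδ, hm⟩ := (isUnitIn_fundamentalUnit hd').exists_dvd_sqrt_mul_sqrt_mem hp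
    (fun y hy => by rcases (Nat.dvd_prime hq).1 hy with rfl | rfl; exacts [⟨1, by simp⟩, hqp])
    hpd hdpq hd (one_lt_fundamentalUnit hd').le h
  rcases (Nat.dvd_prime hq).1 hδ with rfl | rfl
  · exact absurd hm (sqrt_mul_sqrt_fundamentalUnit_notMem hd' one_ne_zero (.inl ⟨1, rfl⟩))
  · exact hm

end FundamentalUnits

section FundamentalSystems

variable {K : IntermediateField ℚ ℝ} {a c p q : ℕ} {x y : ℝ}

lemma mem_of_sqrt_mul_mem (hc : c ≠ 0) (hcK : √(c : ℝ) ∈ K) (hx : √(c : ℝ) * x ∈ K) : x ∈ K := by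
  have hc' : √(c : ℝ) ≠ 0 := by positivity
  simpa [hc'] using div_mem hx hcK

lemma sqrt_notMem_of_sqrt_mul_sqrt_mem (hx0 : 0 < x) (hcK : √(c : ℝ) ∉ K)
    (hx : √(c : ℝ) * √x ∈ K) : √x ∉ K := fun h =>
  hcK (by simpa [(Real.sqrt_pos.2 hx0).ne'] using div_mem hx h)

lemma sqrt_mul_mem_of_sqrt_mul_sqrt_mem (hc : c ≠ 0) (hx0 : 0 ≤ x) (hx : √(c : ℝ) * √x ∈ K)
    (hy : √(c : ℝ) * √y ∈ K) : √(x * y) ∈ K := by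
  have hc' : (c : ℝ) ≠ 0 := Nat.cast_ne_zero.2 hc
  have hprod : √(x * y) = √(c : ℝ) * √x * (√(c : ℝ) * √y) / c := by
    rw [eq_div_iff hc', Real.sqrt_mul hx0]
    linear_combination (-(√x * √y)) * sq_sqrt_natCast c
  rw [hprod]
  exact div_mem (mul_mem hx hy) (natCast_mem K c)

lemma squarefree_two_mul_mul (hp : p.Prime) (hq : q.Prime) (hp2 : p ≠ 2) (hq2 : q ≠ 2)
    (hpq : p ≠ q) : Squarefree (2 * p * q) := by
  refine (Nat.squarefree_mul (.mul_left ?_ ?_)).2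
    ⟨(Nat.squarefree_mul ?_).2 ⟨Nat.prime_two.squarefree, hp.prime.squarefree⟩,
      hq.prime.squarefree⟩
  · exact (Nat.coprime_primes Nat.prime_two hq).2 hq2.symm
  · exact (Nat.coprime_primes hp hq).2 hpq
  · exact (Nat.coprime_primes Nat.prime_two hp).2 hp2.symm

lemma isSquare_of_legendreSym_eq_one [Fact p.Prime] [Fact q.Prime] (hp : p % 4 = 1)
    (hq : q ≠ 2) (h : legendreSym q (p : ℤ) = 1) : IsSquare (q : ZMod p) := by
  rw [legendreSym.quadratic_reciprocity_one_mod_four hp hq] at h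
  have hq0 : ((q : ℤ) : ZMod p) ≠ 0 := fun h0 => by
    simp [(legendreSym.eq_zero_iff p q).2 h0] at h
  simpa using (legendreSym.eq_one_iff p hq0).1 h

theorem isFSU_biquadraticField_two_prime [Fact q.Prime] (hq : q % 4 = 3) :
    IsFSU (biquadraticField 2 q)
      ![fundamentalUnit 2, √(fundamentalUnit q), √(fundamentalUnit (2 * q))] := by
  have hq' : q.Prime := Fact.out
  have hsf : Squarefree (2 * q) := (Nat.squarefree_mul <|
    (Nat.coprime_primes Nat.prime_two hq').2 (by omega)).2
      ⟨Nat.prime_two.squarefree, hq'.prime.squarefree⟩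
  have hN := hasNorm_fundamentalUnit_one hq dvd_rfl hq'.prime.squarefree
  have hN' := hasNorm_fundamentalUnit_one hq (dvd_mul_left q 2) hsf
  have h2 := sqrt_mem_biquadraticField_left 2 q
  refine (spansUnitSquares_fundamentalUnit Nat.prime_two.prime.not_isSquare hq'.prime.not_isSquare
    (not_isSquare_of_prime_dvd hq' (dvd_mul_left q 2) hsf)
    hasNorm_fundamentalUnit_two hN').isFSU_sqrt_sqrt
    (mem_of_sqrt_mul_mem two_ne_zero h2 ?_) (mem_of_sqrt_mul_mem two_ne_zero h2 ?_)
  · exact quadraticField_le (sqrt_mem_biquadraticField_right 2 q)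
      (sqrt_two_mul_sqrt_fundamentalUnit_mem hq' (.inl rfl) hq'.prime.squarefree hN)
  · exact quadraticField_le (sqrt_mul_mem_biquadraticField 2 q)
      (sqrt_two_mul_sqrt_fundamentalUnit_mem hq' (.inr rfl) hsf hN')

theorem isFSU_biquadraticField_of_sqrt_two_notMem [Fact p.Prime] [Fact q.Prime] (hp : p % 8 = 5)
    (hq : q % 4 = 3) (hqp : IsSquare (q : ZMod p)) (hpa : p ∣ a) (hap : a ∣ 2 * p)
    (h2 : √((2 : ℕ) : ℝ) ∉ biquadraticField a q) :
    IsFSU (biquadraticField a q)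
      ![fundamentalUnit a, fundamentalUnit q, √(fundamentalUnit (a * q))] := by
  have hp' : p.Prime := Fact.out
  have hq' : q.Prime := Fact.out
  have hsf : Squarefree (a * q) :=
    (squarefree_two_mul_mul hp' hq' (by omega) (by omega) (by omega)).squarefree_of_dvd
      (mul_dvd_mul_right hap q)
  have ha : Squarefree a := hsf.squarefree_of_dvd (dvd_mul_right a q)
  have hN := hasNorm_fundamentalUnit_one hq dvd_rfl hq'.prime.squarefree
  have hN' := hasNorm_fundamentalUnit_one hq (dvd_mul_left q a) hsf
  refine (spansUnitSquares_fundamentalUnit (not_isSquare_of_prime_dvd hp' hpa ha)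
    hq'.prime.not_isSquare (not_isSquare_of_prime_dvd hq' (dvd_mul_left q a) hsf)
    (hasNorm_fundamentalUnit_neg_one hp hpa hap ha) hN').isFSU_sqrt_right
    (sqrt_notMem_of_sqrt_mul_sqrt_mem (fundamentalUnit_pos hq'.prime.not_isSquare) h2 ?_)
    (mem_of_sqrt_mul_mem hq'.ne_zero (sqrt_mem_biquadraticField_right a q) ?_)
  · exact quadraticField_le (sqrt_mem_biquadraticField_right a q)
      (sqrt_two_mul_sqrt_fundamentalUnit_mem hq' (.inl rfl) hq'.prime.squarefree hN)
  · exact quadraticField_le (sqrt_mul_mem_biquadraticField a q)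
      (sqrt_prime_mul_sqrt_fundamentalUnit_mem hp hq' hqp (hpa.mul_right q)
        (by rw [← mul_assoc]; exact mul_dvd_mul_right hap q) hsf hN')

theorem isFSU_biquadraticField_prime_prime [Fact p.Prime] [Fact q.Prime] (hp : p % 8 = 5)
    (hq : q % 4 = 3) (hqp : IsSquare (q : ZMod p)) :
    IsFSU (biquadraticField p q)
      ![fundamentalUnit p, fundamentalUnit q, √(fundamentalUnit (p * q))] := by
  have hsf : Squarefree (2 * p * q) :=
    squarefree_two_mul_mul Fact.out Fact.out (by omega) (by omega) (by omega)
  refine isFSU_biquadraticField_of_sqrt_two_notMem hp hq hqp dvd_rfl (dvd_mul_left p 2) ?_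
  exact sqrt_notMem_biquadraticField (by convert hsf using 1; ring) (by norm_num)

theorem isFSU_biquadraticField_two_mul_prime_prime [Fact p.Prime] [Fact q.Prime] (hp : p % 8 = 5)
    (hq : q % 4 = 3) (hqp : IsSquare (q : ZMod p)) :
    IsFSU (biquadraticField (2 * p) q)
      ![fundamentalUnit (2 * p), fundamentalUnit q, √(fundamentalUnit (2 * p * q))] := by
  have hsf : Squarefree (2 * p * q) :=
    squarefree_two_mul_mul Fact.out Fact.out (by omega) (by omega) (by omega)
  refine isFSU_biquadraticField_of_sqrt_two_notMem hp hq hqp (dvd_mul_left p 2) dvd_rfl ?_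
  rw [biquadraticField_comm]
  exact sqrt_notMem_biquadraticField_mul hsf (by norm_num) (Fact.out : p.Prime).ne_one

theorem isFSU_biquadraticField_prime_two_mul_prime [Fact p.Prime] [Fact q.Prime] (hp : p % 8 = 5)
    (hq : q % 4 = 3) (hqp : IsSquare (q : ZMod p)) :
    IsFSU (biquadraticField p (2 * q))
      ![fundamentalUnit p, fundamentalUnit (2 * q),
        √(fundamentalUnit (2 * q) * fundamentalUnit (2 * p * q))] := by
  have hp' : p.Prime := Fact.out
  have hq' : q.Prime := Fact.out
  have hsf : Squarefree (p * (2 * q)) := by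
    convert squarefree_two_mul_mul hp' hq' (by omega) (by omega) (by omega) using 1; ring
  have h2q : Squarefree (2 * q) := hsf.squarefree_of_dvd (dvd_mul_left _ p)
  have hd := not_isSquare_of_prime_dvd hq' (dvd_mul_left q 2) h2q
  have hN := hasNorm_fundamentalUnit_one hq (dvd_mul_left q 2) h2q
  have hN' := hasNorm_fundamentalUnit_one hq (dvd_mul_of_dvd_right (dvd_mul_left q 2) p) hsf
  have hm := quadraticField_le (sqrt_mem_biquadraticField_right p (2 * q))
    (sqrt_two_mul_sqrt_fundamentalUnit_mem hq' (.inr rfl) h2q hN)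
  rw [show 2 * p * q = p * (2 * q) by ring]
  refine (spansUnitSquares_fundamentalUnit hp'.prime.not_isSquare hd
    (not_isSquare_of_prime_dvd hp' (dvd_mul_right p _) hsf)
    (hasNorm_fundamentalUnit_neg_one hp dvd_rfl (dvd_mul_left p 2) hp'.prime.squarefree)
    hN').mul_right.isFSU_sqrt_right
    (sqrt_notMem_of_sqrt_mul_sqrt_mem (fundamentalUnit_pos hd) ?_ hm)
    (sqrt_mul_mem_of_sqrt_mul_sqrt_mem hq'.ne_zero (fundamentalUnit_pos hd).le ?_ ?_)
  · exact sqrt_notMem_biquadraticField_mul (by convert hsf using 1; ring) (by norm_num)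
      hq'.ne_one
  · exact sqrt_mul_mem_of_isSquare_mul ⟨2 * q, by ring⟩ two_ne_zero h2q.ne_zero
      (sqrt_mem_biquadraticField_right p (2 * q)) hm
  · exact quadraticField_le (sqrt_mul_mem_biquadraticField p (2 * q))
      (sqrt_prime_mul_sqrt_fundamentalUnit_mem hp hq' hqp (dvd_mul_right p _)
        ⟨1, by ring⟩ hsf hN')

theorem isFSU_biquadraticField_two_prime_mul_prime [Fact p.Prime] [Fact q.Prime] (hp : p % 8 = 5)
    (hq : q % 4 = 3) (hqp : IsSquare (q : ZMod p)) :
    IsFSU (biquadraticField 2 (p * q))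
      ![fundamentalUnit 2, fundamentalUnit (p * q),
        √(fundamentalUnit (p * q) * fundamentalUnit (2 * p * q))] := by
  have hp' : p.Prime := Fact.out
  have hq' : q.Prime := Fact.out
  have hsf : Squarefree (2 * (p * q)) := by
    rw [← mul_assoc]
    exact squarefree_two_mul_mul hp' hq' (by omega) (by omega) (by omega)
  have hpq : Squarefree (p * q) := hsf.squarefree_of_dvd (dvd_mul_left _ 2)
  have hd := not_isSquare_of_prime_dvd hq' (dvd_mul_left q p) hpq
  have hN := hasNorm_fundamentalUnit_one hq (dvd_mul_left q p) hpq
  have hN' := hasNorm_fundamentalUnit_one hq (dvd_mul_of_dvd_right (dvd_mul_left q p) 2) hsf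
  have hm := quadraticField_le (sqrt_mem_biquadraticField_right 2 (p * q))
    (sqrt_prime_mul_sqrt_fundamentalUnit_mem hp hq' hqp (dvd_mul_right p q) (dvd_mul_left _ 2)
      hpq hN)
  rw [mul_assoc]
  refine (spansUnitSquares_fundamentalUnit Nat.prime_two.prime.not_isSquare hd
    (not_isSquare_of_prime_dvd hq' (dvd_mul_of_dvd_right (dvd_mul_left q p) 2) hsf)
    hasNorm_fundamentalUnit_two hN').mul_right.isFSU_sqrt_right
    (sqrt_notMem_of_sqrt_mul_sqrt_mem (fundamentalUnit_pos hd) ?_ hm)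
    (sqrt_mul_mem_of_sqrt_mul_sqrt_mem hq'.ne_zero (fundamentalUnit_pos hd).le hm ?_)
  · rw [mul_comm p]
    exact sqrt_notMem_biquadraticField_mul (by convert hsf using 1; ring) hq'.ne_one hp'.ne_one
  · exact quadraticField_le (sqrt_mul_mem_biquadraticField 2 (p * q))
      (sqrt_prime_mul_sqrt_fundamentalUnit_mem hp hq' hqp
        (dvd_mul_of_dvd_right (dvd_mul_right p q) 2) dvd_rfl hsf hN')

end FundamentalSystems

theorem mainTheorem6_general (p q : ℕ) [Fact p.Prime] [Fact q.Prime]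
    (hp : p ≡ 5 [MOD 8]) (hq : q ≡ 3 [MOD 4]) (hpq : legendreSym q (p : ℤ) = 1) :
    IsFSU (biquadraticField p q)
      ![fundamentalUnit p, fundamentalUnit q, √(fundamentalUnit (p * q))] ∧
    IsFSU (biquadraticField 2 q)
      ![fundamentalUnit 2, √(fundamentalUnit q), √(fundamentalUnit (2 * q))] ∧
    IsFSU (biquadraticField p (2 * q))
      ![fundamentalUnit p, fundamentalUnit (2 * q),
        √(fundamentalUnit (2 * q) * fundamentalUnit (2 * p * q))] ∧
    IsFSU (biquadraticField q (2 * p))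
      ![fundamentalUnit q, fundamentalUnit (2 * p), √(fundamentalUnit (2 * p * q))] ∧
    IsFSU (biquadraticField 2 (p * q))
      ![fundamentalUnit 2, fundamentalUnit (p * q),
        √(fundamentalUnit (p * q) * fundamentalUnit (2 * p * q))] := by
  have hp' : p % 8 = 5 := hp
  have hq' : q % 4 = 3 := hq
  have hqp : IsSquare (q : ZMod p) :=
    isSquare_of_legendreSym_eq_one (by omega) (by omega) hpq
  refine ⟨isFSU_biquadraticField_prime_prime hp' hq' hqp, isFSU_biquadraticField_two_prime hq',
    isFSU_biquadraticField_prime_two_mul_prime hp' hq' hqp, ?_,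
    isFSU_biquadraticField_two_prime_mul_prime hp' hq' hqp⟩
  rw [biquadraticField_comm]
  convert (isFSU_biquadraticField_two_mul_prime_prime hp' hq' hqp).comp_perm (Equiv.swap 0 1)
  ext i; fin_cases i <;> rfl

theorem mainTheorem6 (p q : ℕ) [Fact p.Prime] [Fact q.Prime]
    (hp : p ≡ 5 [MOD 8]) (hq : q ≡ 3 [MOD 8]) (hpq : legendreSym q (p : ℤ) = 1) :
    IsFSU (biquadraticField p q)
      ![fundamentalUnit p, fundamentalUnit q, √(fundamentalUnit (p * q))] ∧
    IsFSU (biquadraticField 2 q)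
      ![fundamentalUnit 2, √(fundamentalUnit q), √(fundamentalUnit (2 * q))] ∧
    IsFSU (biquadraticField p (2 * q))
      ![fundamentalUnit p, fundamentalUnit (2 * q),
        √(fundamentalUnit (2 * q) * fundamentalUnit (2 * p * q))] ∧
    IsFSU (biquadraticField q (2 * p))
      ![fundamentalUnit q, fundamentalUnit (2 * p), √(fundamentalUnit (2 * p * q))] ∧
    IsFSU (biquadraticField 2 (p * q))
      ![fundamentalUnit 2, fundamentalUnit (p * q),
        √(fundamentalUnit (p * q) * fundamentalUnit (2 * p * q))] :=
  mainTheorem6_general p q hp (hq.of_dvd (by norm_num)) hpq
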